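/- A directed graph has a set $N$ of nodes, a set $E$ of edges, and for every edge $\xi$ a tail $-\xi\in N$ and a head $+\xi\in N$. A CFSM protocol with finite communication graph $G=(N,E)$ consists of pairwise disjoint finite message sets $M_\xi$ ($\xi\in E$) and, for every node $j\in N$, a finite set $K_j$ of states, an initial state $h_j\in K_j$ and a set $T_j\subseteq K_j\times\Sigma_j\times K_j$ of transitions, where $\Sigma_j=\{+b : b\in M_\xi,\ j=+\xi\}\cup\{-b : b\in M_\xi,\ j=-\xi\}$. A composite state is a vector $S=(p_j)_{j\in N}$ with $p_j\in K_j$, a channel content is a vector $C=(x_\xi)_{\xi\in E}$ of strings $x_\xi\in M_\xi^*$, and a global state is a pair $(S,C)$. In one step, the machine at one node $i$ executes a transition $(p_i,e,q_i)\in T_i$, all other machines keeping their states: if $e=+b$ with $b\in M_\beta$, then the first symbol of $x_\beta$ must be $b$ and it is removed; if $e=-b$ with $b\in M_\beta$, then $b$ is appended at the end of $x_\beta$; the other channels are unchanged. A global state is reachable if some finite sequence of steps leads to it from $(S^0,C^0)$, where $S^0=(h_j)_{j\in N}$ and $C^0$ has all channels empty. A composite state $S$ is stable if $(S,C^0)$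 is reachable. The protocol has the rational channel property if for every composite state $S$ the relation $$\mathbf L(S)=\{C : (S,C)\text{ is reachable}\}\subseteq\prod_{\xi\in E}M_\xi^*$$ is rational, that is, belongs to the least family of subsets of the product monoid $\prod_{\xi\in E}M_\xi^*$ that contains the finite subsets and is closed under union, product and generated submonoid. **Theorem.** Let $G$ be the graph $0\rightleftarrows 1\to 2\rightleftarrows 3$ with the nodes $0,1,2,3$ and exactly the five edges $0\to1$, $1\to0$, $1\to2$, $3\to2$, $2\to3$. The problem "Is a given composite state stable?" is algorithmically decidable for the CFSM protocols with the rational channel property and the communication graph $G$: there is an algorithm that, given (a finite description of) any such protocol and any composite state $S$ of it, halts and answers correctly whether $S$ is stable. (The behaviour of the algorithm on protocols without the rational channel property is not specified.) -/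

import Mathlib

universe u v

open scoped Pointwise

/-- A directed graph with node set `N` and edge set `E` (loops and parallel edges allowed):
the edge `ξ` leads from its tail `-ξ` to its head `+ξ`. -/
structure DiGraph (N E : Type) where
  tail : E → N
  head : E → N

/-- The alphabet `Σ_j` of the machine at node `j`: the receptions `+b` of messages `b` of the
channels that enter `j`, and the transmissions `-b` of messages `b` of the channels that
leave `j`.  The message sets of different channels are made disjoint by the tag `ξ`. -/
inductive CommAction {N E : Type} (G : DiGraph N E) (M : E → Type v) (j : N) : Type v
  | recv (ξ : E) (h : G.head ξ = j) (b : M ξ)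
  | send (ξ : E) (h : G.tail ξ = j) (b : M ξ)

/-- A protocol of communicating finite state machines with communication graph `G`. -/
structure CFSMProtocol {N E : Type} (G : DiGraph N E) where
  /-- the message set of each channel -/
  M : E → Type v
  /-- the state set of each machine -/
  K : N → Type u
  finite_M : ∀ ξ, Finite (M ξ)
  finite_K : ∀ j, Finite (K j)
  /-- the initial state of each machine -/
  init : ∀ j, K j
  /-- the set of transitions `(p, e, q)` of each machine -/
  trans : ∀ j, Set (K j × CommAction G M j × K j)

namespace CFSMProtocol

variable {N E : Type} {G : DiGraph N E} (P : CFSMProtocol.{u, v} G)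

/-- A composite state: one local state for every node. -/
abbrev CompositeState : Type u := ∀ j, P.K j

/-- A channel content: one string of messages for every edge.  The product of free monoids is a
monoid under componentwise concatenation, and its unit `1` has all channels empty. -/
abbrev ChannelContent : Type v := ∀ ξ, FreeMonoid (P.M ξ)

/-- A global state. -/
abbrev GlobalState : Type (max u v) := P.CompositeState × P.ChannelContent

/-- One step between global states.  A reception removes the first message of the channel, a
transmission appends a message at the end of the channel. -/
inductive Step : P.GlobalState → P.GlobalState → Prop
  | recv {S S' : P.CompositeState} {C C' : P.ChannelContent} (i : N) (β : E)
      (h : G.head β = i) (b : P.M β)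
      (hT : (S i, CommAction.recv β h b, S' i) ∈ P.trans i)
      (hS : ∀ j, j ≠ i → S j = S' j)
      (hC : ∀ ξ, ξ ≠ β → C ξ = C' ξ)
      (hβ : C β = FreeMonoid.of b * C' β) : Step (S, C) (S', C')
  | send {S S' : P.CompositeState} {C C' : P.ChannelContent} (i : N) (β : E)
      (h : G.tail β = i) (b : P.M β)
      (hT : (S i, CommAction.send β h b, S' i) ∈ P.trans i)
      (hS : ∀ j, j ≠ i → S j = S' j)
      (hC : ∀ ξ, ξ ≠ β → C ξ = C' ξ)
      (hβ : C' β = C β * FreeMonoid.of b) : Step (S, C) (S', C')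

/-- The global state `g` is reachable from the initial global state (all machines in their
initial states and all channels empty). -/
def Reachable (g : P.GlobalState) : Prop :=
  Relation.ReflTransGen P.Step (P.init, 1) g

/-- The composite state `S` is stable: `S` with all channels empty is reachable. -/
def Stable (S : P.CompositeState) : Prop := P.Reachable (S, 1)

/-- The relation `L(S)` of all channel contents that can coexist with `S`. -/
def contents (S : P.CompositeState) : Set P.ChannelContent := {C | P.Reachable (S, C)}

end CFSMProtocol

/-- The rational subsets of a monoid: the least family that contains the finite subsets and is
closed under union, product and generated submonoid (star).  A rational relation between strings
is a rational subset of a product of free monoids. -/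
inductive IsRationalSubset {A : Type v} [Monoid A] : Set A → Prop
  | finite {s : Set A} (hs : s.Finite) : IsRationalSubset s
  | union {s t : Set A} (hs : IsRationalSubset s) (ht : IsRationalSubset t) :
      IsRationalSubset (s ∪ t)
  | mul {s t : Set A} (hs : IsRationalSubset s) (ht : IsRationalSubset t) :
      IsRationalSubset (s * t)
  | star {s : Set A} (hs : IsRationalSubset s) :
      IsRationalSubset (Submonoid.closure s : Set A)

/-- The rational channel property: `L(S)` is a rational relation for every composite
state `S`. -/
def CFSMProtocol.RationalChannelProperty {N E : Type} {G : DiGraph N E}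
    (P : CFSMProtocol.{u, v} G) : Prop :=
  ∀ S : P.CompositeState, IsRationalSubset (P.contents S)

/-- Transitions written with numbers: the number of the source state, `true` for a reception or
`false` for a transmission, the edge, the number of the message, the number of the target
state. -/
abbrev TransitionCode (e : ℕ) : Type := ℕ × Bool × Fin e × ℕ × ℕ

/-- The inputs of algorithms, for a graph with nodes `Fin n` and edges `Fin e`: the sizes of the
message sets, the sizes of the state sets, the numbers of the initial states, the lists of
transitions, and the numbers of the local states of a composite state. -/
abbrev InstanceCode (n e : ℕ) : Type :=
  (Fin e → ℕ) × (Fin n → ℕ) × (Fin n → ℕ) × (Fin n → List (TransitionCode e)) × (Fin n → ℕ)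

namespace CFSMProtocol

variable {n e : ℕ} {G : DiGraph (Fin n) (Fin e)}

/-- A way to write a protocol down: an enumeration of each message set and of each state set, and
a list (in any order, repetitions allowed) of the transitions of each machine.  Every protocol
has one, because its sets are finite. -/
structure Presentation (P : CFSMProtocol.{u, v} G) where
  numM : Fin e → ℕ
  numK : Fin n → ℕ
  enumM : ∀ ξ, P.M ξ ≃ Fin (numM ξ)
  enumK : ∀ j, P.K j ≃ Fin (numK j)
  list : ∀ j, List (P.K j × CommAction G P.M j × P.K j)
  mem_list : ∀ j t, t ∈ list j ↔ t ∈ P.trans j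

namespace Presentation

variable {P : CFSMProtocol.{u, v} G} (D : P.Presentation)

/-- A transition written with numbers. -/
def transitionCode (j : Fin n) : P.K j × CommAction G P.M j × P.K j → TransitionCode e
  | (p, CommAction.recv ξ _ b, q) => (D.enumK j p, true, ξ, D.enumM ξ b, D.enumK j q)
  | (p, CommAction.send ξ _ b, q) => (D.enumK j p, false, ξ, D.enumM ξ b, D.enumK j q)

/-- The input that describes the protocol together with the composite state `S`. -/
def code (S : P.CompositeState) : InstanceCode n e :=
  (D.numM, D.numK, fun j => (D.enumK j (P.init j) : ℕ),
    fun j => (D.list j).map (D.transitionCode j), fun j => (D.enumK j (S j) : ℕ))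

end Presentation

end CFSMProtocol

/-- Algorithmic decidability of the problem "Is a given composite state stable?" for the
protocols with communication graph `G` that have the property `𝒞`: one algorithm (a partial
recursive function) halts with the correct answer on every description of a protocol with
the property `𝒞` and a composite state of it.  Nothing is required on other inputs. -/
def StableCompositeStateDecidable {n e : ℕ} (G : DiGraph (Fin n) (Fin e))
    (𝒞 : CFSMProtocol.{u, v} G → Prop) : Prop :=
  ∃ f : InstanceCode n e →. Bool, Partrec f ∧
    ∀ P : CFSMProtocol.{u, v} G, 𝒞 P → ∀ (D : P.Presentation) (S : P.CompositeState),
      ∃ a : Bool, a ∈ f (D.code S) ∧ (a = true ↔ P.Stable S)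

/-- The communication graph `0 ⇄ 1 → 2 ⇄ 3`: four nodes, and five edges
`α : 0 → 1`, `β : 1 → 0`, `γ : 1 → 2`, `δ : 3 → 2`, `ε : 2 → 3`, numbered `0, …, 4`. -/
def twoPairsGraph : DiGraph (Fin 4) (Fin 5) where
  tail := ![0, 1, 1, 3, 2]
  head := ![1, 0, 2, 2, 3]

/-! Two searches run in parallel: one for a run that ends in the given state with empty channels,
the other for a finite certificate that there is no such run. The rational channel property ensures
that an unstable state has a certificate.

The machines at `0` and `3` talk only to their partners. Hence a run that ends with channels `0` and
`3` empty can be rearranged so that each message of these channels is received as soon as it is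
sent. Each pair becomes one machine with one queue (channel `1` or `4`); the left one writes a word
to channel `2`, the right one reads it, and nothing flows back (`reachable_iff_loopReach`).

A certificate consists of a finite monoid for queue contents, a finite monoid for words of channel
`2`, and two finite sets: `I`, of triples (left state, class of the queue, class of the written
word), and `J`, of triples (right state, class of the queue, class of the word still to be read).
Both are closed under the moves, `J` starts from the final triples of `I` with empty queue, and `J`
misses the accepting triple. Closed sets contain the classes of all reachable configurations, so a
certificate is sound (`Refutation.Valid.not_accepts`).

For completeness (`exists_refutation`), `I` and `J` are the exact images of reachable
configurations. Appending a letter respects every congruence. Removing a first letter is the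
difficulty: a word may have the class of `b x'` without beginning with `b`. It is overcome by
monoids that recognize the relevant languages, namely sections of the relations L(S) in which one
channel is kept, another is restricted to a class of a finite monoid, and others are empty. Rational
subsets of the product of a free and a finite monoid have finitely many left quotients
(`IsRationalSubset.finite_range_leftQuot`), so suitable monoids exist (`exists_recognizing_monoid`).
-/

/-! ### A ring of two machines as one machine with a queue -/

/-- The actions of a machine with one queue attached to itself: a silent move, a transmission to
the queue, a reception from the queue, and the handling of one message of an external word. -/
inductive LoopAct (M C : Type*)
  | silent
  | push (b : M)
  | pop (b : M)
  | ext (c : C)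

/-- `LoopReach tr i p x w`: from state `i` and empty queue the machine reaches the state `p` with
the queue content `x`, and `w` is the word of the external messages on the way. -/
inductive LoopReach {K M C : Type*} (tr : K → LoopAct M C → K → Prop) (i : K) :
    K → List M → List C → Prop
  | init : LoopReach tr i i [] []
  | silent {p q x w} : LoopReach tr i p x w → tr p .silent q → LoopReach tr i q x w
  | push {p q x w b} : LoopReach tr i p x w → tr p (.push b) q → LoopReach tr i q (x ++ [b]) w
  | pop {p q x w b} : LoopReach tr i p (b :: x) w → tr p (.pop b) q → LoopReach tr i q x w
  | ext {p q x w c} : LoopReach tr i p x w → tr p (.ext c) q → LoopReach tr i q x (w ++ [c])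

theorem LoopReach.trans {K M C : Type*} {tr : K → LoopAct M C → K → Prop} {i j p : K} {x : List M}
    {w w' : List C} (h : LoopReach tr i j [] w') (h' : LoopReach tr j p x w) :
    LoopReach tr i p x (w' ++ w) := by
  induction h' with
  | init => simpa using h
  | silent _ ht ih => exact ih.silent ht
  | push _ ht ih => exact ih.push ht
  | pop _ ht ih => exact ih.pop ht
  | ext _ ht ih => rw [← List.append_assoc]; exact ih.ext ht

section Pair

variable {X Y A M C : Type*}

/-- Two machines in a ring as one machine with a queue: the messages from the outer machine to
the inner machine are handed over immediately, and those from the inner to the outer machine go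
through the queue. -/
inductive PairTr (oSend : X → A → X → Prop) (oRecv : X → M → X → Prop) (iRecv : Y → A → Y → Prop)
    (iSend : Y → M → Y → Prop) (iExt : Y → C → Y → Prop) : X × Y → LoopAct M C → X × Y → Prop
  | hand {s s' t t' a} : oSend s a s' → iRecv t a t' →
      PairTr oSend oRecv iRecv iSend iExt (s, t) .silent (s', t')
  | pop {s s' t b} : oRecv s b s' → PairTr oSend oRecv iRecv iSend iExt (s, t) (.pop b) (s', t)
  | push {s t t' b} : iSend t b t' → PairTr oSend oRecv iRecv iSend iExt (s, t) (.push b) (s, t')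
  | ext {s t t' c} : iExt t c t' → PairTr oSend oRecv iRecv iSend iExt (s, t) (.ext c) (s, t')

/-- A run of one machine from the first to the last state that sends `a` and receives `u`. -/
inductive Solo (oSend : X → A → X → Prop) (oRecv : X → M → X → Prop) (s : X) :
    List A → List M → X → Prop
  | nil : Solo oSend oRecv s [] [] s
  | send {a u s' s'' b} : Solo oSend oRecv s a u s' → oSend s' b s'' →
      Solo oSend oRecv s (a ++ [b]) u s''
  | recv {a u s' s'' b} : Solo oSend oRecv s a u s' → oRecv s' b s'' →
      Solo oSend oRecv s a (u ++ [b]) s''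

variable {oSend : X → A → X → Prop} {oRecv : X → M → X → Prop} {iRecv : Y → A → Y → Prop}
  {iSend : Y → M → Y → Prop} {iExt : Y → C → Y → Prop}

/-- Cutting at the first transmission allows a postponed run of the outer machine to be executed
exactly as far as the message that the inner machine is about to receive. -/
theorem Solo.split {s s'' : X} {l : List A} {u : List M} (h : Solo oSend oRecv s l u s'') :
    ∀ b a, l = b :: a → ∃ u₁ u₂ t t', u = u₁ ++ u₂ ∧ Solo oSend oRecv s [] u₁ t ∧ oSend t b t' ∧
      Solo oSend oRecv t' a u₂ s'' := by
  induction h with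
  | nil => intro b a h; simp at h
  | @send l u s' s'' c h hs ih =>
    intro b a hl
    cases l with
    | nil =>
      simp only [List.nil_append, List.cons.injEq] at hl
      obtain ⟨rfl, rfl⟩ := hl
      exact ⟨u, [], s', s'', by simp, h, hs, .nil⟩
    | cons d l =>
      simp only [List.cons_append, List.cons.injEq] at hl
      obtain ⟨rfl, rfl⟩ := hl
      obtain ⟨u₁, u₂, t, t', rfl, h1, h2, h3⟩ := ih _ _ rfl
      exact ⟨u₁, u₂, t, t', rfl, h1, h2, h3.send hs⟩
  | @recv l u s' s'' c h hs ih =>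
    intro b a hl
    obtain ⟨u₁, u₂, t, t', rfl, h1, h2, h3⟩ := ih _ _ hl
    exact ⟨u₁, u₂ ++ [c], t, t', by simp, h1, h2, h3.recv hs⟩

/-- Without transmissions, the outer machine only takes messages from the queue, and these are moves
of the combined machine. -/
theorem LoopReach.pops {i : X × Y} {s s' : X} {t : Y} {a : List A} {u : List M} {w : List C}
    (h : Solo oSend oRecv s a u s') : a = [] →
    ∀ x, LoopReach (PairTr oSend oRecv iRecv iSend iExt) i (s, t) (u ++ x) w →
      LoopReach (PairTr oSend oRecv iRecv iSend iExt) i (s', t) x w := by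
  induction h with
  | nil => exact fun _ _ h => h
  | send => intro h; simp at h
  | @recv a u s' s'' b h hr ih =>
    intro ha x hx
    exact (ih ha (b :: x) (by simpa using hx)).pop (.pop hr)

/-- The states of a ring of two machines: the run can be rearranged into a run of the machine
`PairTr` followed by a run of the outer machine alone. -/
def PairInv (oSend : X → A → X → Prop) (oRecv : X → M → X → Prop) (iRecv : Y → A → Y → Prop)
    (iSend : Y → M → Y → Prop) (iExt : Y → C → Y → Prop) (i : X × Y) (s : X) (t : Y)
    (a : List A) (x : List M) (w : List C) : Prop :=
  ∃ s' u, LoopReach (PairTr oSend oRecv iRecv iSend iExt) i (s', t) (u ++ x) w ∧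
    Solo oSend oRecv s' a u s

namespace PairInv

variable {i : X × Y} {s s' : X} {t t' : Y} {a : List A} {x : List M} {w : List C}

theorem init : PairInv oSend oRecv iRecv iSend iExt i i.1 i.2 [] [] [] :=
  ⟨i.1, [], .init, .nil⟩

theorem loopReach (h : PairInv oSend oRecv iRecv iSend iExt i s t [] x w) :
    LoopReach (PairTr oSend oRecv iRecv iSend iExt) i (s, t) x w := by
  obtain ⟨s', u, h, hs⟩ := h
  exact LoopReach.pops hs rfl x h

theorem outerSend {b : A} (h : PairInv oSend oRecv iRecv iSend iExt i s t a x w)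
    (hb : oSend s b s') : PairInv oSend oRecv iRecv iSend iExt i s' t (a ++ [b]) x w := by
  obtain ⟨r, u, h, hs⟩ := h
  exact ⟨r, u, h, hs.send hb⟩

/-- The combined machine does not move: the message passes from the actual queue `x` to the word `u`
that the postponed run has yet to take, and `u ++ x` as a whole is unchanged. -/
theorem outerRecv {b : M} (h : PairInv oSend oRecv iRecv iSend iExt i s t a (b :: x) w)
    (hb : oRecv s b s') : PairInv oSend oRecv iRecv iSend iExt i s' t a x w := by
  obtain ⟨r, u, h, hs⟩ := h
  exact ⟨r, u ++ [b], by simpa using h, hs.recv hb⟩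

theorem innerSend {b : M} (h : PairInv oSend oRecv iRecv iSend iExt i s t a x w)
    (hb : iSend t b t') : PairInv oSend oRecv iRecv iSend iExt i s t' a (x ++ [b]) w := by
  obtain ⟨r, u, h, hs⟩ := h
  exact ⟨r, u, by rw [← List.append_assoc]; exact h.push (.push hb), hs⟩

theorem innerExt {c : C} (h : PairInv oSend oRecv iRecv iSend iExt i s t a x w)
    (hb : iExt t c t') : PairInv oSend oRecv iRecv iSend iExt i s t' a x (w ++ [c]) := by
  obtain ⟨r, u, h, hs⟩ := h
  exact ⟨r, u, h.ext (.ext hb), hs⟩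

/-- Only here does the postponed run shrink: its receptions before the first transmission are
executed, this transmission merges with the reception into one silent move, and the rest stays
postponed. -/
theorem innerRecv {b : A} (h : PairInv oSend oRecv iRecv iSend iExt i s t (b :: a) x w)
    (hb : iRecv t b t') : PairInv oSend oRecv iRecv iSend iExt i s t' a x w := by
  obtain ⟨r, u, h, hs⟩ := h
  obtain ⟨u₁, u₂, r₁, r₂, rfl, h1, h2, h3⟩ := hs.split _ _ rfl
  exact ⟨r₂, u₂, (LoopReach.pops h1 rfl _ (by simpa using h)).silent (.hand h2 hb), h3⟩

end PairInv

end Pair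

/-! ### Reachable global states as pairs of runs of two machines with queues -/

namespace CFSMProtocol

variable (P : CFSMProtocol.{u, v} twoPairsGraph)

/-- The machines at the nodes `0` and `1` as one machine with a queue. -/
def leftTr : P.K 0 × P.K 1 → LoopAct (P.M 1) (P.M 2) → P.K 0 × P.K 1 → Prop :=
  PairTr (fun s (b : P.M 0) s' => (s, .send 0 rfl b, s') ∈ P.trans 0)
    (fun s b s' => (s, .recv 1 rfl b, s') ∈ P.trans 0)
    (fun s b s' => (s, .recv 0 rfl b, s') ∈ P.trans 1)
    (fun s b s' => (s, .send 1 rfl b, s') ∈ P.trans 1)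
    (fun s b s' => (s, .send 2 rfl b, s') ∈ P.trans 1)

/-- The machines at the nodes `3` and `2` as one machine with a queue. -/
def rightTr : P.K 3 × P.K 2 → LoopAct (P.M 4) (P.M 2) → P.K 3 × P.K 2 → Prop :=
  PairTr (fun s (b : P.M 3) s' => (s, .send 3 rfl b, s') ∈ P.trans 3)
    (fun s b s' => (s, .recv 4 rfl b, s') ∈ P.trans 3)
    (fun s b s' => (s, .recv 3 rfl b, s') ∈ P.trans 2)
    (fun s b s' => (s, .send 4 rfl b, s') ∈ P.trans 2)
    (fun s b s' => (s, .recv 2 rfl b, s') ∈ P.trans 2)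

/-- The invariant of all reachable global states. -/
def TwoPairsInv (g : P.GlobalState) : Prop :=
  ∃ w : List (P.M 2),
    PairInv (fun s (b : P.M 0) s' => (s, .send 0 rfl b, s') ∈ P.trans 0)
      (fun s b s' => (s, .recv 1 rfl b, s') ∈ P.trans 0)
      (fun s b s' => (s, .recv 0 rfl b, s') ∈ P.trans 1)
      (fun s b s' => (s, .send 1 rfl b, s') ∈ P.trans 1)
      (fun s b s' => (s, .send 2 rfl b, s') ∈ P.trans 1)
      (P.init 0, P.init 1) (g.1 0) (g.1 1) (g.2 0).toList (g.2 1).toList (w ++ (g.2 2).toList) ∧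
    PairInv (fun s (b : P.M 3) s' => (s, .send 3 rfl b, s') ∈ P.trans 3)
      (fun s b s' => (s, .recv 4 rfl b, s') ∈ P.trans 3)
      (fun s b s' => (s, .recv 3 rfl b, s') ∈ P.trans 2)
      (fun s b s' => (s, .send 4 rfl b, s') ∈ P.trans 2)
      (fun s b s' => (s, .recv 2 rfl b, s') ∈ P.trans 2)
      (P.init 3, P.init 2) (g.1 3) (g.1 2) (g.2 3).toList (g.2 4).toList w

theorem twoPairsInv_of_reachable {g : P.GlobalState} (hg : P.Reachable g) : P.TwoPairsInv g := by
  induction hg with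
  | refl => exact ⟨[], PairInv.init, PairInv.init⟩
  | tail _ hstep ih =>
    obtain ⟨w, hl, hr⟩ := ih
    cases hstep with
    | @recv S S' C C' i β h b hT hS hC hβ =>
      subst h
      fin_cases β
      · change P.M 0 at b
        have hT' : (S 1, CommAction.recv 0 rfl b, S' 1) ∈ P.trans 1 := hT
        have hβ' : (C 0).toList = b :: (C' 0).toList := congrArg FreeMonoid.toList hβ
        simp only [hβ'] at hl
        refine ⟨w, ?_, ?_⟩
        · simpa only [← hS 0 (by decide), ← hC 1 (by decide),
          ← hC 2 (by decide)] using hl.innerRecv hT'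
        · simpa only [← hS 3 (by decide), ← hS 2 (by decide), ← hC 3 (by decide),
          ← hC 4 (by decide)] using hr
      · change P.M 1 at b
        have hT' : (S 0, CommAction.recv 1 rfl b, S' 0) ∈ P.trans 0 := hT
        have hβ' : (C 1).toList = b :: (C' 1).toList := congrArg FreeMonoid.toList hβ
        simp only [hβ'] at hl
        refine ⟨w, ?_, ?_⟩
        · simpa only [← hS 1 (by decide), ← hC 0 (by decide),
          ← hC 2 (by decide)] using hl.outerRecv hT'
        · simpa only [← hS 3 (by decide), ← hS 2 (by decide), ← hC 3 (by decide),
          ← hC 4 (by decide)] using hr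
      · change P.M 2 at b
        have hT' : (S 2, CommAction.recv 2 rfl b, S' 2) ∈ P.trans 2 := hT
        have hβ' : (C 2).toList = b :: (C' 2).toList := congrArg FreeMonoid.toList hβ
        simp only [hβ'] at hl
        -- The message passes from channel `2` to the word already read, so the total word written
        -- by the left pair is unchanged.
        refine ⟨w ++ [b], ?_, ?_⟩
        · simpa [← hS 0 (by decide), ← hS 1 (by decide), ← hC 0 (by decide),
          ← hC 1 (by decide)] using hl
        · simpa only [← hS 3 (by decide), ← hC 3 (by decide),
          ← hC 4 (by decide)] using hr.innerExt hT'
      · change P.M 3 at b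
        have hT' : (S 2, CommAction.recv 3 rfl b, S' 2) ∈ P.trans 2 := hT
        have hβ' : (C 3).toList = b :: (C' 3).toList := congrArg FreeMonoid.toList hβ
        simp only [hβ'] at hr
        refine ⟨w, ?_, ?_⟩
        · simpa only [← hS 0 (by decide), ← hS 1 (by decide), ← hC 0 (by decide),
          ← hC 1 (by decide), ← hC 2 (by decide)] using hl
        · simpa only [← hS 3 (by decide), ← hC 4 (by decide)] using hr.innerRecv hT'
      · change P.M 4 at b
        have hT' : (S 3, CommAction.recv 4 rfl b, S' 3) ∈ P.trans 3 := hT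
        have hβ' : (C 4).toList = b :: (C' 4).toList := congrArg FreeMonoid.toList hβ
        simp only [hβ'] at hr
        refine ⟨w, ?_, ?_⟩
        · simpa only [← hS 0 (by decide), ← hS 1 (by decide), ← hC 0 (by decide),
          ← hC 1 (by decide), ← hC 2 (by decide)] using hl
        · simpa only [← hS 2 (by decide), ← hC 3 (by decide)] using hr.outerRecv hT'
    | @send S S' C C' i β h b hT hS hC hβ =>
      subst h
      fin_cases β
      · change P.M 0 at b
        have hT' : (S 0, CommAction.send 0 rfl b, S' 0) ∈ P.trans 0 := hT
        have hβ' : (C' 0).toList = (C 0).toList ++ [b] := congrArg FreeMonoid.toList hβ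
        refine ⟨w, ?_, ?_⟩
        · simpa only [hβ', ← hS 1 (by decide), ← hC 1 (by decide),
          ← hC 2 (by decide)] using hl.outerSend hT'
        · simpa only [← hS 3 (by decide), ← hS 2 (by decide), ← hC 3 (by decide),
          ← hC 4 (by decide)] using hr
      · change P.M 1 at b
        have hT' : (S 1, CommAction.send 1 rfl b, S' 1) ∈ P.trans 1 := hT
        have hβ' : (C' 1).toList = (C 1).toList ++ [b] := congrArg FreeMonoid.toList hβ
        refine ⟨w, ?_, ?_⟩
        · simpa only [hβ', ← hS 0 (by decide), ← hC 0 (by decide),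
          ← hC 2 (by decide)] using hl.innerSend hT'
        · simpa only [← hS 3 (by decide), ← hS 2 (by decide), ← hC 3 (by decide),
          ← hC 4 (by decide)] using hr
      · change P.M 2 at b
        have hT' : (S 1, CommAction.send 2 rfl b, S' 1) ∈ P.trans 1 := hT
        have hβ' : (C' 2).toList = (C 2).toList ++ [b] := congrArg FreeMonoid.toList hβ
        refine ⟨w, ?_, ?_⟩
        · simpa only [hβ', ← List.append_assoc, ← hS 0 (by decide), ← hC 0 (by decide),
          ← hC 1 (by decide)] using hl.innerExt hT'
        · simpa only [← hS 3 (by decide), ← hS 2 (by decide), ← hC 3 (by decide),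
          ← hC 4 (by decide)] using hr
      · change P.M 3 at b
        have hT' : (S 3, CommAction.send 3 rfl b, S' 3) ∈ P.trans 3 := hT
        have hβ' : (C' 3).toList = (C 3).toList ++ [b] := congrArg FreeMonoid.toList hβ
        refine ⟨w, ?_, ?_⟩
        · simpa only [← hS 0 (by decide), ← hS 1 (by decide), ← hC 0 (by decide),
          ← hC 1 (by decide), ← hC 2 (by decide)] using hl
        · simpa only [hβ', ← hS 2 (by decide), ← hC 4 (by decide)] using hr.outerSend hT'
      · change P.M 4 at b
        have hT' : (S 2, CommAction.send 4 rfl b, S' 2) ∈ P.trans 2 := hT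
        have hβ' : (C' 4).toList = (C 4).toList ++ [b] := congrArg FreeMonoid.toList hβ
        refine ⟨w, ?_, ?_⟩
        · simpa only [← hS 0 (by decide), ← hS 1 (by decide), ← hC 0 (by decide),
          ← hC 1 (by decide), ← hC 2 (by decide)] using hl
        · simpa only [hβ', ← hS 3 (by decide), ← hC 3 (by decide)] using hr.innerSend hT'

end CFSMProtocol

namespace CFSMProtocol

variable {P : CFSMProtocol.{u, v} twoPairsGraph}

theorem Reachable.recv {S : P.CompositeState} {C : P.ChannelContent} (h : P.Reachable (S, C))
    (i : Fin 4) (β : Fin 5) (hi : twoPairsGraph.head β = i) (b : P.M β) (q : P.K i)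
    (x : List (P.M β)) (hT : (S i, CommAction.recv β hi b, q) ∈ P.trans i)
    (hx : (C β).toList = b :: x) :
    P.Reachable (Function.update S i q, Function.update C β (FreeMonoid.ofList x)) := by
  refine Relation.ReflTransGen.tail h (Step.recv i β hi b (by simpa using hT) ?_ ?_ ?_)
  · intro j hj; simp [hj]
  · intro ξ hξ; simp [hξ]
  · rw [Function.update_self]; exact hx

theorem Reachable.send {S : P.CompositeState} {C : P.ChannelContent} (h : P.Reachable (S, C))
    (i : Fin 4) (β : Fin 5) (hi : twoPairsGraph.tail β = i) (b : P.M β) (q : P.K i)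
    (hT : (S i, CommAction.send β hi b, q) ∈ P.trans i) :
    P.Reachable (Function.update S i q,
      Function.update C β (FreeMonoid.ofList ((C β).toList ++ [b]))) := by
  refine Relation.ReflTransGen.tail h (Step.send i β hi b (by simpa using hT) ?_ ?_ ?_)
  · intro j hj; simp [hj]
  · intro ξ hξ; simp [hξ]
  · rw [Function.update_self]; rfl

variable (P) in
/-- The reachability of the global state with given states of the two pairs of machines and
given contents of the channels `1`, `2`, `4`, the channels `0` and `3` being empty. -/
def Realized (p : P.K 0 × P.K 1) (q : P.K 3 × P.K 2) (x : List (P.M 1)) (z : List (P.M 2))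
    (y : List (P.M 4)) : Prop :=
  ∃ S C, P.Reachable (S, C) ∧ S 0 = p.1 ∧ S 1 = p.2 ∧ S 3 = q.1 ∧ S 2 = q.2 ∧
    (C 0).toList = [] ∧ (C 1).toList = x ∧ (C 2).toList = z ∧ (C 3).toList = [] ∧
    (C 4).toList = y

/-- The right pair rests while the left pair runs; a silent move is a transmission followed at once
by its reception. -/
theorem realized_left {p x w} (h : LoopReach P.leftTr (P.init 0, P.init 1) p x w) :
    P.Realized p (P.init 3, P.init 2) x w [] := by
  induction h with
  | init => exact ⟨P.init, 1, .refl, rfl, rfl, rfl, rfl, rfl, rfl, rfl, rfl, rfl⟩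
  | silent _ ht ih =>
    obtain ⟨S, C, hr, h0, h1, h3, h2, c0, c1, c2, c3, c4⟩ := ih
    cases ht with
    | hand ha hb =>
      have hr := hr.send 0 0 rfl _ _ (by simpa [h0] using ha)
      have hr := hr.recv 1 0 rfl _ _ [] (by simpa [h1] using hb) (by simp [c0])
      exact ⟨_, _, hr, by simpa using ⟨h3, h2, c1, c2, c3, c4⟩⟩
  | push _ ht ih =>
    obtain ⟨S, C, hr, h0, h1, h3, h2, c0, c1, c2, c3, c4⟩ := ih
    cases ht with
    | push ha =>
      have hr := hr.send 1 1 rfl _ _ (by simpa [h1] using ha)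
      exact ⟨_, _, hr, by simpa using ⟨h0, h3, h2, c0, c1, c2, c3, c4⟩⟩
  | pop _ ht ih =>
    obtain ⟨S, C, hr, h0, h1, h3, h2, c0, c1, c2, c3, c4⟩ := ih
    cases ht with
    | pop ha =>
      have hr := hr.recv 0 1 rfl _ _ _ (by simpa [h0] using ha) c1
      exact ⟨_, _, hr, by simpa using ⟨h1, h3, h2, c0, c2, c3, c4⟩⟩
  | ext _ ht ih =>
    obtain ⟨S, C, hr, h0, h1, h3, h2, c0, c1, c2, c3, c4⟩ := ih
    cases ht with
    | ext ha =>
      have hr := hr.send 1 2 rfl _ _ (by simpa [h1] using ha)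
      exact ⟨_, _, hr, by simpa using ⟨h0, h3, h2, c0, c1, c2, c3, c4⟩⟩

/-- Since nothing flows back, the left run can be completed before the right one starts. The unread
word `z` is general because one step less of reading leaves one more letter in the channel. -/
theorem realized_right {p x q y w} (h : LoopReach P.rightTr (P.init 3, P.init 2) q y w) :
    ∀ z, LoopReach P.leftTr (P.init 0, P.init 1) p x (w ++ z) → P.Realized p q x z y := by
  induction h with
  | init => exact fun z hz => realized_left hz
  | silent _ ht ih =>
    intro z hz
    obtain ⟨S, C, hr, h0, h1, h3, h2, c0, c1, c2, c3, c4⟩ := ih z hz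
    cases ht with
    | hand ha hb =>
      have hr := hr.send 3 3 rfl _ _ (by simpa [h3] using ha)
      have hr := hr.recv 2 3 rfl _ _ [] (by simpa [h2] using hb) (by simp [c3])
      exact ⟨_, _, hr, by simpa using ⟨h0, h1, c0, c1, c2, c4⟩⟩
  | push _ ht ih =>
    intro z hz
    obtain ⟨S, C, hr, h0, h1, h3, h2, c0, c1, c2, c3, c4⟩ := ih z hz
    cases ht with
    | push ha =>
      have hr := hr.send 2 4 rfl _ _ (by simpa [h2] using ha)
      exact ⟨_, _, hr, by simpa using ⟨h0, h1, h3, c0, c1, c2, c3, c4⟩⟩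
  | pop _ ht ih =>
    intro z hz
    obtain ⟨S, C, hr, h0, h1, h3, h2, c0, c1, c2, c3, c4⟩ := ih z hz
    cases ht with
    | pop ha =>
      have hr := hr.recv 3 4 rfl _ _ _ (by simpa [h3] using ha) c4
      exact ⟨_, _, hr, by simpa using ⟨h0, h1, h2, c0, c1, c2, c3⟩⟩
  | @ext _ _ _ _ c _ ht ih =>
    intro z hz
    obtain ⟨S, C, hr, h0, h1, h3, h2, c0, c1, c2, c3, c4⟩ := ih (c :: z) (by simpa using hz)
    cases ht with
    | ext ha =>
      have hr := hr.recv 2 2 rfl _ _ _ (by simpa [h2] using ha) c2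
      exact ⟨_, _, hr, by simpa using ⟨h0, h1, h3, c0, c1, c3, c4⟩⟩

/-- The reachable global states with the channels `0` and `3` empty, in terms of the runs of the
two pairs of machines. -/
theorem reachable_iff_loopReach {S : P.CompositeState} {C : P.ChannelContent} (h0 : C 0 = 1)
    (h3 : C 3 = 1) : P.Reachable (S, C) ↔
      ∃ w, LoopReach P.leftTr (P.init 0, P.init 1) (S 0, S 1) (C 1).toList (w ++ (C 2).toList) ∧
        LoopReach P.rightTr (P.init 3, P.init 2) (S 3, S 2) (C 4).toList w := by
  constructor
  · intro h
    obtain ⟨w, hl, hr⟩ := P.twoPairsInv_of_reachable h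
    refine ⟨w, ?_, ?_⟩
    · exact PairInv.loopReach (by simpa [h0] using hl)
    · exact PairInv.loopReach (by simpa [h3] using hr)
  · rintro ⟨w, hl, hr⟩
    obtain ⟨S', C', h, e0, e1, e3, e2, c0, c1, c2, c3, c4⟩ := realized_right hr _ hl
    have hS : S' = S := by
      funext j; fin_cases j
      exacts [e0, e1, e2, e3]
    have hC : C' = C := by
      funext j; fin_cases j
      exacts [c0.trans h0.symm, c1, c2, c3.trans h3.symm, c4]
    rwa [← hS, ← hC]

end CFSMProtocol

/-! ### Rational subsets, left quotients and recognizing monoids -/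

theorem IsRationalSubset.image {A : Type u} {B : Type v} [Monoid A] [Monoid B] (f : A →* B)
    {s : Set A} (hs : IsRationalSubset s) : IsRationalSubset (f '' s) := by
  induction hs with
  | finite hs => exact .finite (hs.image f)
  | union _ _ h1 h2 => rw [Set.image_union]; exact .union h1 h2
  | mul _ _ h1 h2 => rw [Set.image_mul]; exact .mul h1 h2
  | @star s _ h =>
    have : f '' (Submonoid.closure s : Set A) = (Submonoid.closure (f '' s) : Set B) := by
      rw [← MonoidHom.map_mclosure, Submonoid.coe_map]
    rw [this]; exact .star h

theorem FreeMonoid.mul_eq_mul_iff {X : Type*} {a b c d : FreeMonoid X} :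
    a * b = c * d ↔ (∃ e, c = a * e ∧ b = e * d) ∨ ∃ e, a = c * e ∧ d = e * b :=
  List.append_eq_append_iff

section Quotient

variable {X F : Type*}

/-- The left quotient of a set of words with values in a second monoid by a word. -/
def leftQuot (s : Set (FreeMonoid X × F)) (w : FreeMonoid X) : Set (FreeMonoid X × F) :=
  {p | (w * p.1, p.2) ∈ s}

theorem finite_range_leftQuot_of_finite {s : Set (FreeMonoid X × F)} (hs : s.Finite) :
    (Set.range (leftQuot s)).Finite := by
  have hsub : {p : FreeMonoid X × F | ∃ w, (w * p.1, p.2) ∈ s}.Finite := by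
    have : {p : FreeMonoid X × F | ∃ w, (w * p.1, p.2) ∈ s} ⊆
        ⋃ q ∈ s, {x : FreeMonoid X | x.toList ∈ q.1.toList.tails} ×ˢ {q.2} := by
      rintro ⟨x, f⟩ ⟨w, h⟩
      simp only [Set.mem_iUnion, Set.mem_prod, Set.mem_ofPred_eq, List.mem_tails]
      exact ⟨_, h, ⟨w.toList, rfl⟩, rfl⟩
    refine Set.Finite.subset (hs.biUnion fun q _ => Set.Finite.prod ?_ (Set.finite_singleton _))
      this
    exact List.finite_toSet q.1.toList.tails
  refine hsub.finite_subsets.subset ?_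
  rintro _ ⟨w, rfl⟩ p hp
  exact ⟨w, hp⟩

variable [Monoid F] [Finite F]

/-- A prefix `w` of a product ends either inside the first factor, which leaves a quotient of `s`,
or inside the second one. In the latter case only the value of the first factor in `F` and a
quotient of `t` matter, and there are finitely many such pairs. -/
theorem finite_range_leftQuot_mul {s t : Set (FreeMonoid X × F)}
    (hs : (Set.range (leftQuot s)).Finite) (ht : (Set.range (leftQuot t)).Finite) :
    (Set.range (leftQuot (s * t))).Finite := by
  have hT := (Set.finite_univ (α := F)).prod ht
  refine (Set.Finite.image2 (fun (Y : Set (FreeMonoid X × F)) T => Y * t ∪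
    {p | ∃ a ∈ (T : Set (F × Set (FreeMonoid X × F))), ∃ f, (p.1, f) ∈ a.2 ∧ p.2 = a.1 * f})
    hs hT.finite_subsets).subset ?_
  rintro _ ⟨w, rfl⟩
  refine ⟨_, ⟨w, rfl⟩, {a | ∃ b w', (b, a.1) ∈ s ∧ w = b * w' ∧ a.2 = leftQuot t w'}, ?_, ?_⟩
  · rintro ⟨f, Y⟩ ⟨b, w', _, _, h⟩
    exact ⟨trivial, w', h.symm⟩
  · ext ⟨x, f⟩
    simp only [Set.mem_union, Set.mem_mul, leftQuot, Set.mem_ofPred_eq, Prod.exists, Prod.mk_mul_mk,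
      Prod.mk.injEq]
    constructor
    · rintro (⟨a, f1, ha, b, f2, hb, rfl, rfl⟩ | ⟨f1, _, ⟨b, w', hb, rfl, rfl⟩, f2, h2, rfl⟩)
      · exact ⟨_, f1, ha, b, f2, hb, by simp [mul_assoc], rfl⟩
      · exact ⟨b, f1, hb, _, f2, h2, by simp [mul_assoc], rfl⟩
    · rintro ⟨a, f1, ha, b, f2, hb, h, rfl⟩
      obtain ⟨e, rfl, rfl⟩ | ⟨e, rfl, rfl⟩ := FreeMonoid.mul_eq_mul_iff.1 h
      · exact .inr ⟨f1, _, ⟨a, e, ha, rfl, rfl⟩, f2, hb, rfl⟩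
      · exact .inl ⟨e, f1, ha, b, f2, hb, rfl, rfl⟩

/-- A prefix `w` of a product of factors from `s` ends between two factors or inside one. The
completed factors matter only through their value in `F`, the interrupted one through a quotient of
`s`. -/
theorem finite_range_leftQuot_closure {s : Set (FreeMonoid X × F)}
    (hs : (Set.range (leftQuot s)).Finite) :
    (Set.range (leftQuot (Submonoid.closure s : Set (FreeMonoid X × F)))).Finite := by
  set c := Submonoid.closure s with hc
  have hT := (Set.finite_univ (α := F)).prod hs
  refine (Set.Finite.image2 (fun (E : Set F) T =>
    {p | (∃ f ∈ E, ∃ q ∈ c, p = (1, f) * q) ∨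
      ∃ a ∈ (T : Set (F × Set (FreeMonoid X × F))), ∃ r ∈ a.2, ∃ q ∈ c, p = (1, a.1) * r * q})
    (Set.finite_univ (α := F)).finite_subsets hT.finite_subsets).subset ?_
  rintro _ ⟨w, rfl⟩
  refine ⟨{f | (w, f) ∈ c}, Set.subset_univ _,
    {a | ∃ b w', (b, a.1) ∈ c ∧ w = b * w' ∧ a.2 = leftQuot s w'}, ?_, ?_⟩
  · rintro ⟨f, Y⟩ ⟨b, w', _, _, h⟩
    exact ⟨trivial, w', h.symm⟩
  · apply Set.Subset.antisymm
    · rintro p (⟨f, hf, ⟨q1, q2⟩, hq, rfl⟩ |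
        ⟨⟨f, _⟩, ⟨b, w', hb, rfl, rfl⟩, ⟨r1, r2⟩, hr, ⟨q1, q2⟩, hq, rfl⟩)
      · have := c.mul_mem hf hq
        simpa [leftQuot] using this
      · have := c.mul_mem (c.mul_mem hb (Submonoid.subset_closure hr)) hq
        simpa [leftQuot, mul_assoc] using this
    -- The cut is general, because splitting off the first factor shortens the prefix: the cut lies
    -- either beyond this factor, where the induction hypothesis applies, or inside it.
    · have key : ∀ p ∈ c, ∀ w x f, p = (w * x, f) →
          (∃ g, (w, g) ∈ c ∧ ∃ q ∈ c, ((x, f) : FreeMonoid X × F) = (1, g) * q) ∨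
          ∃ g b w', (b, g) ∈ c ∧ w = b * w' ∧ ∃ r ∈ leftQuot s w', ∃ q ∈ c,
            ((x, f) : FreeMonoid X × F) = (1, g) * r * q := by
        intro p hp
        induction hp using Submonoid.closure_induction_left with
        | one =>
          intro w x f h
          simp only [Prod.ext_iff, Prod.fst_one, Prod.snd_one] at h
          obtain ⟨h, rfl⟩ := h
          obtain ⟨rfl, rfl⟩ : w = 1 ∧ x = 1 := List.append_eq_nil_iff.1 h.symm
          exact .inl ⟨1, c.one_mem, 1, c.one_mem, by simp⟩
        | mul_left p hp q hq ih =>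
          intro w x f h
          obtain ⟨a, f1⟩ := p
          obtain ⟨b, f2⟩ := q
          simp only [Prod.mk_mul_mk, Prod.mk.injEq] at h
          obtain ⟨h, rfl⟩ := h
          obtain ⟨e, rfl, rfl⟩ | ⟨e, rfl, rfl⟩ := FreeMonoid.mul_eq_mul_iff.1 h
          · obtain ⟨g, hg, r, hr, h⟩ | ⟨g, b, w', hb, rfl, r, hr, q, hq, h⟩ := ih e x f2 rfl
            · refine .inl ⟨f1 * g, c.mul_mem (Submonoid.subset_closure hp) hg, r, hr, ?_⟩
              simp only [Prod.ext_iff, Prod.fst_mul, Prod.snd_mul] at h ⊢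
              exact ⟨h.1, by rw [h.2, mul_assoc]⟩
            · refine .inr ⟨f1 * g, a * b, w', c.mul_mem (Submonoid.subset_closure hp) hb,
                by rw [mul_assoc], r, hr, q, hq, ?_⟩
              simp only [Prod.ext_iff, Prod.fst_mul, Prod.snd_mul] at h ⊢
              exact ⟨h.1, by rw [h.2]; simp only [mul_assoc]⟩
          · exact .inr ⟨1, 1, w, c.one_mem, (one_mul w).symm, (e, f1), hp, (b, f2), hq, by simp⟩
      rintro ⟨x, f⟩ hp
      obtain ⟨g, hg, h⟩ | ⟨g, b, w', hb, hw, h⟩ := key _ hp w x f rfl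
      · exact .inl ⟨g, hg, h⟩
      · exact .inr ⟨(g, leftQuot s w'), ⟨b, w', hb, hw, rfl⟩, h⟩

theorem IsRationalSubset.finite_range_leftQuot {X : Type v} {F : Type v} [Monoid F] [Finite F]
    {s : Set (FreeMonoid X × F)} (hs : IsRationalSubset s) : (Set.range (leftQuot s)).Finite := by
  induction hs with
  | finite hs => exact finite_range_leftQuot_of_finite hs
  | @union s t _ _ h1 h2 =>
    refine (h1.image2 (· ∪ ·) h2).subset ?_
    rintro _ ⟨w, rfl⟩
    exact ⟨_, ⟨w, rfl⟩, _, ⟨w, rfl⟩, rfl⟩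
  | mul _ _ h1 h2 => exact finite_range_leftQuot_mul h1 h2
  | star _ h => exact finite_range_leftQuot_closure h

end Quotient

/-- A set of words with finitely many left quotients. -/
def FinQuot {X : Type*} (L : Set (FreeMonoid X)) : Prop :=
  (Set.range fun w : FreeMonoid X => {u | w * u ∈ L}).Finite

theorem finQuot_of_finite {X : Type} {L : Set (FreeMonoid X)} (hL : L.Finite) : FinQuot L := by
  have h := finite_range_leftQuot_of_finite (hL.prod (Set.finite_singleton (1 : Unit)))
  refine (h.image fun Y : Set (FreeMonoid X × Unit) => {u | (u, 1) ∈ Y}).subset ?_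
  rintro _ ⟨w, rfl⟩
  exact ⟨_, ⟨w, rfl⟩, by ext u; simp [leftQuot]⟩

/-- The words of the elements of a rational set that have a given value in a finite monoid. -/
theorem IsRationalSubset.finQuot {A : Type u} [Monoid A] {X F : Type} [Monoid F] [Finite F]
    {s : Set A} (hs : IsRationalSubset s) (π : A →* FreeMonoid X) (ψ : A →* F) (f : F) :
    FinQuot {x | ∃ a ∈ s, π a = x ∧ ψ a = f} := by
  have h := (hs.image (π.prod ψ)).finite_range_leftQuot
  refine (h.image fun Y : Set (FreeMonoid X × F) => {u | (u, f) ∈ Y}).subset ?_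
  rintro _ ⟨w, rfl⟩
  exact ⟨_, ⟨w, rfl⟩, by ext u; simp [leftQuot]⟩

/-- Finitely many sets of words with finitely many left quotients are recognized by one
finite monoid. -/
theorem exists_recognizing_monoid {X ι : Type} [Finite ι] (L : ι → Set (FreeMonoid X))
    (hL : ∀ i, FinQuot (L i)) :
    ∃ (H : Type) (_ : Monoid H) (_ : Finite H) (φ : FreeMonoid X →* H),
      Function.Surjective φ ∧ ∀ i x y, φ x = φ y → x ∈ L i → y ∈ L i := by
  -- The left quotients are the states of the minimal automaton of `L i`. Words act on them from the
  -- right, hence the opposite monoid below.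
  let D : ι → Type := fun i => Set.range fun w : FreeMonoid X => {u | w * u ∈ L i}
  have : ∀ i, Finite (D i) := fun i => (hL i).to_subtype
  let act : X → ∀ i, D i → D i := fun b i d => ⟨{u | FreeMonoid.of b * u ∈ d.1}, by
    obtain ⟨_, w, rfl⟩ := d
    exact ⟨w * FreeMonoid.of b, by simp [mul_assoc]⟩⟩
  let Φ : FreeMonoid X →* ∀ i, (Function.End (D i))ᵐᵒᵖ :=
    FreeMonoid.lift fun b i => MulOpposite.op (act b i)
  have hΦ : ∀ (w : FreeMonoid X) i (d : D i),
      ((Φ w i).unop d).1 = {u | w * u ∈ d.1} := by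
    intro w
    induction w using FreeMonoid.inductionOn' with
    | one => intro i d; simp; rfl
    | of_mul b w ih =>
      intro i d
      have : (Φ (FreeMonoid.of b * w) i).unop d = (Φ w i).unop (act b i d) := by
        simp [Φ, map_mul]; rfl
      rw [this, ih]
      ext u
      simp [act, mul_assoc]
  have : ∀ i, Finite (Function.End (D i))ᵐᵒᵖ := fun i =>
    Finite.of_equiv (D i → D i) MulOpposite.opEquiv
  refine ⟨MonoidHom.mrange Φ, inferInstance, inferInstance, Φ.mrangeRestrict,
    Φ.mrangeRestrict_surjective, fun i x y h hx => ?_⟩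
  have hxy : Φ x = Φ y := congrArg Subtype.val h
  have h1 := hΦ x i ⟨_, 1, rfl⟩
  rw [hxy, hΦ y i ⟨_, 1, rfl⟩] at h1
  have h2 : (1 : FreeMonoid X) ∈ {u : FreeMonoid X | x * u ∈ {u | 1 * u ∈ L i}} := by
    simpa using hx
  rw [← h1] at h2
  simpa using h2

/-! ### Refutations and their soundness -/

/-- The kind and the letter of an action. -/
def LoopAct.code : LoopAct ℕ ℕ → ℕ × ℕ
  | silent => (0, 0)
  | push b => (1, b)
  | pop b => (2, b)
  | ext c => (3, c)

/-- The transitions of a machine with a queue, written with numbers: the source state, the kind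
and the letter of the action, and the target state. -/
abbrev LoopTrans : Type := (ℕ × ℕ) × (ℕ × ℕ) × (ℕ × ℕ)

/-- The transition relation given by a list. -/
def listTr (T : List LoopTrans) (p : ℕ × ℕ) (a : LoopAct ℕ ℕ) (q : ℕ × ℕ) : Prop :=
  (p, a.code, q) ∈ T

/-- Two machines with queues, each with an initial and a final state. The first machine writes
the external word that the second machine reads. -/
abbrev LoopPair : Type :=
  (List LoopTrans × (ℕ × ℕ) × (ℕ × ℕ)) × (List LoopTrans × (ℕ × ℕ) × (ℕ × ℕ))

namespace LoopPair

/-- The two machines reach the states `p` and `q` with queues `x` and `y`, and `z` remains to be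
read. -/
def Joint (D : LoopPair) (p q : ℕ × ℕ) (x z y : List ℕ) : Prop :=
  ∃ w, LoopReach (listTr D.1.1) D.1.2.1 p x (w ++ z) ∧ LoopReach (listTr D.2.1) D.2.2.1 q y w

/-- Both machines reach their final states with all queues empty. -/
def Accepts (D : LoopPair) : Prop := D.Joint D.1.2.2 D.2.2.2 [] [] []

end LoopPair

/-- The value of a function of two numbers stored in a list. -/
def lookup (c : List ℕ) (b h : ℕ) : ℕ := c.getD (Nat.pair b h) 0

theorem exists_lookup (f : ℕ → ℕ → ℕ) (N m : ℕ) :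
    ∃ c, ∀ b < N, ∀ h < m, lookup c b h = f b h := by
  -- The list is long enough because `Nat.pair b h < (max b h + 1) ^ 2`.
  refine ⟨(List.range ((max N m + 1) ^ 2)).map fun k => f k.unpair.1 k.unpair.2,
    fun b hb h hh => ?_⟩
  have hlt : Nat.pair b h < (max N m + 1) ^ 2 :=
    (Nat.pair_lt_max_add_one_sq b h).trans_le (Nat.pow_le_pow_left (by omega) 2)
  simp [lookup, List.getD, hlt]

/-- A finite monoid generated by letters, given by its order `m` and by the tables of the left
and right multiplications by the letters; its elements are the numbers less than `m`, and `0` is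
the unit. -/
abbrev ActTable : Type := ℕ × List ℕ × List ℕ

namespace ActTable

/-- Multiplication by a letter from the left. -/
def l (t : ActTable) (b h : ℕ) : ℕ := lookup t.2.1 b h

/-- Multiplication by a letter from the right. -/
def r (t : ActTable) (h b : ℕ) : ℕ := lookup t.2.2 b h

/-- The two multiplications by the letters less than `N` are compatible. -/
def Valid (t : ActTable) (N : ℕ) : Prop :=
  0 < t.1 ∧ ∀ b < N, t.l b 0 = t.r 0 b ∧
    ∀ h < t.1, (t.l b h < t.1 ∧ t.r h b < t.1) ∧ ∀ c < N, t.l b (t.r h c) = t.r (t.l b h) c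

/-- The value of a word. -/
def val (t : ActTable) (x : List ℕ) : ℕ := x.foldl t.r 0

variable {t : ActTable} {N : ℕ}

@[simp] theorem val_nil : t.val [] = 0 := rfl

@[simp] theorem val_concat (x : List ℕ) (b : ℕ) : t.val (x ++ [b]) = t.r (t.val x) b := by
  simp [val]

theorem val_lt (h : t.Valid N) (x : List ℕ) (hx : ∀ b ∈ x, b < N) : t.val x < t.1 := by
  induction x using List.reverseRecOn with
  | nil => exact h.1
  | append_singleton x b ih =>
    rw [val_concat]
    exact ((h.2 b (hx b (by simp))).2 _ (ih fun c hc => hx c (by simp [hc]))).1.2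

/-- The first letter moves past the appended ones because left and right multiplications commute.
This is all the associativity needed, so no full multiplication table is stored. -/
theorem val_cons (h : t.Valid N) (b : ℕ) (x : List ℕ) (hb : b < N) (hx : ∀ b ∈ x, b < N) :
    t.val (b :: x) = t.l b (t.val x) := by
  induction x using List.reverseRecOn with
  | nil => exact (h.2 b hb).1.symm
  | append_singleton x c ih =>
    have hx' : ∀ b ∈ x, b < N := fun c hc => hx c (by simp [hc])
    rw [← List.cons_append, val_concat, val_concat, ih hx']
    exact (((h.2 b hb).2 _ (val_lt h x hx')).2 c (hx c (by simp))).symm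

end ActTable

/-- A refutation of `LoopPair.Accepts`: a bound for the letters, a monoid for the queues, a monoid
for the external words, and invariants of the two machines. -/
abbrev Refutation : Type :=
  ℕ × ActTable × ActTable × List ((ℕ × ℕ) × ℕ × ℕ) × List ((ℕ × ℕ) × ℕ × ℕ)

/-- The invariant `I` is closed under the transitions of a machine that writes. -/
def WriterClosed (t s : ActTable) (I : List ((ℕ × ℕ) × ℕ × ℕ)) (T : List LoopTrans) : Prop :=
  ∀ a ∈ T, ∀ h < t.1, ∀ g < s.1,
    (a.1, (if a.2.1.1 = 2 then t.l a.2.1.2 h else h), g) ∈ I →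
    (a.2.2, (if a.2.1.1 = 1 then t.r h a.2.1.2 else h),
      (if a.2.1.1 = 3 then s.r g a.2.1.2 else g)) ∈ I

/-- The invariant `J` is closed under the transitions of a machine that reads. -/
def ReaderClosed (t s : ActTable) (J : List ((ℕ × ℕ) × ℕ × ℕ)) (T : List LoopTrans) : Prop :=
  ∀ a ∈ T, ∀ h < t.1, ∀ g < s.1,
    (a.1, (if a.2.1.1 = 2 then t.l a.2.1.2 h else h),
      (if a.2.1.1 = 3 then s.l a.2.1.2 g else g)) ∈ J →
    (a.2.2, (if a.2.1.1 = 1 then t.r h a.2.1.2 else h), g) ∈ J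

/-- The conditions that make a refutation correct. -/
def Refutation.Valid (c : Refutation) (D : LoopPair) : Prop :=
  (∀ a ∈ D.1.1, a.2.1.2 < c.1) ∧ (∀ a ∈ D.2.1, a.2.1.2 < c.1) ∧
  c.2.1.Valid c.1 ∧ c.2.2.1.Valid c.1 ∧
  (D.1.2.1, 0, 0) ∈ c.2.2.2.1 ∧ WriterClosed c.2.1 c.2.2.1 c.2.2.2.1 D.1.1 ∧
  (∀ g < c.2.2.1.1, (D.1.2.2, 0, g) ∈ c.2.2.2.1 → (D.2.2.1, 0, g) ∈ c.2.2.2.2) ∧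
  ReaderClosed c.2.1 c.2.2.1 c.2.2.2.2 D.2.1 ∧ (D.2.2.2, 0, 0) ∉ c.2.2.2.2

theorem LoopReach.letter_lt {T : List LoopTrans} {N : ℕ} (hT : ∀ a ∈ T, a.2.1.2 < N)
    {i p : ℕ × ℕ} {x w : List ℕ} (h : LoopReach (listTr T) i p x w) :
    (∀ b ∈ x, b < N) ∧ ∀ b ∈ w, b < N := by
  induction h with
  | init => simp
  | silent _ _ ih => exact ih
  | push _ ht ih =>
    refine ⟨fun b hb => ?_, ih.2⟩
    rcases List.mem_append.1 hb with hb | hb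
    · exact ih.1 b hb
    · rw [List.mem_singleton.1 hb]; exact hT _ ht
  | pop _ ht ih => exact ⟨fun b hb => ih.1 b (by simp [hb]), ih.2⟩
  | ext _ ht ih =>
    refine ⟨ih.1, fun b hb => ?_⟩
    rcases List.mem_append.1 hb with hb | hb
    · exact ih.2 b hb
    · rw [List.mem_singleton.1 hb]; exact hT _ ht

theorem Refutation.Valid.not_accepts {c : Refutation} {D : LoopPair} (hc : c.Valid D) :
    ¬ D.Accepts := by
  obtain ⟨hL, hR, ht, hs, hi, hI, hIJ, hJ, hf⟩ := hc
  have left : ∀ p x w, LoopReach (listTr D.1.1) D.1.2.1 p x w →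
      (p, c.2.1.val x, c.2.2.1.val w) ∈ c.2.2.2.1 := by
    intro p x w h
    induction h with
    | init => exact hi
    | silent h ht' ih =>
      have hlt := h.letter_lt hL
      exact hI _ ht' _ (ActTable.val_lt ht _ hlt.1) _ (ActTable.val_lt hs _ hlt.2) ih
    | push h ht' ih =>
      have hlt := h.letter_lt hL
      rw [ActTable.val_concat]
      exact hI _ ht' _ (ActTable.val_lt ht _ hlt.1) _ (ActTable.val_lt hs _ hlt.2) ih
    | pop h ht' ih =>
      have hlt := h.letter_lt hL
      have hx := fun b hb => hlt.1 b (List.mem_cons_of_mem _ hb)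
      rw [ActTable.val_cons ht _ _ (hlt.1 _ List.mem_cons_self) hx] at ih
      exact hI _ ht' _ (ActTable.val_lt ht _ hx) _ (ActTable.val_lt hs _ hlt.2) ih
    | ext h ht' ih =>
      have hlt := h.letter_lt hL
      rw [ActTable.val_concat]
      exact hI _ ht' _ (ActTable.val_lt ht _ hlt.1) _ (ActTable.val_lt hs _ hlt.2) ih
  rintro ⟨w, hl, hr⟩
  have hl' := left _ _ _ hl
  have hw := (hl.letter_lt hL).2
  simp only [List.append_nil, ActTable.val_nil] at hl' hw
  -- With the total word `w` fixed, the class recorded is that of the unread part `z`; reading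
  -- removes its first letter.
  have right : ∀ q y w', LoopReach (listTr D.2.1) D.2.2.1 q y w' → ∀ z, w' ++ z = w →
      (q, c.2.1.val y, c.2.2.1.val z) ∈ c.2.2.2.2 := by
    intro q y w' h
    induction h with
    | init =>
      rintro z rfl
      exact hIJ _ (ActTable.val_lt hs _ hw) hl'
    | silent h ht' ih =>
      rintro z rfl
      have hz := fun b hb => hw b (List.mem_append_right _ hb)
      have hlt := h.letter_lt hR
      exact hJ _ ht' _ (ActTable.val_lt ht _ hlt.1) _ (ActTable.val_lt hs _ hz) (ih z rfl)
    | push h ht' ih =>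
      rintro z rfl
      have hz := fun b hb => hw b (List.mem_append_right _ hb)
      have hlt := h.letter_lt hR
      rw [ActTable.val_concat]
      exact hJ _ ht' _ (ActTable.val_lt ht _ hlt.1) _ (ActTable.val_lt hs _ hz) (ih z rfl)
    | pop h ht' ih =>
      rintro z rfl
      have hz := fun b hb => hw b (List.mem_append_right _ hb)
      have hlt := h.letter_lt hR
      have hx := fun b hb => hlt.1 b (List.mem_cons_of_mem _ hb)
      have ih := ih z rfl
      rw [ActTable.val_cons ht _ _ (hlt.1 _ List.mem_cons_self) hx] at ih
      exact hJ _ ht' _ (ActTable.val_lt ht _ hx) _ (ActTable.val_lt hs _ hz) ih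
    | @ext _ _ _ _ a h ht' ih =>
      rintro z rfl
      have hz := fun b hb => hw b (List.mem_append_right _ hb)
      have hlt := h.letter_lt hR
      have ih := ih (a :: z) (by simp)
      rw [ActTable.val_cons hs _ _ (hw a (by simp)) hz] at ih
      exact hJ _ ht' _ (ActTable.val_lt ht _ hlt.1) _ (ActTable.val_lt hs _ hz) ih
  exact hf (right _ _ _ hr [] (by simp))

/-! ### Existence of refutations -/

/-- A table for a finite monoid that recognizes given sets of words and the empty word. -/
theorem exists_actTable {ι : Type} [Finite ι] (L : ι → Set (FreeMonoid ℕ))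
    (hL : ∀ i, FinQuot (L i)) (N : ℕ) :
    ∃ (H : Type) (_ : Monoid H) (_ : Finite H) (φ : FreeMonoid ℕ →* H) (enc : H → ℕ)
      (t : ActTable), Function.Surjective φ ∧ Function.Injective enc ∧ enc 1 = 0 ∧
      (∀ h, enc h < t.1) ∧ (∀ n < t.1, ∃ h, enc h = n) ∧
      (∀ b < N, ∀ h, t.l b (enc h) = enc (φ (FreeMonoid.of b) * h)) ∧
      (∀ b < N, ∀ h, t.r (enc h) b = enc (h * φ (FreeMonoid.of b))) ∧
      (∀ i x y, φ x = φ y → x ∈ L i → y ∈ L i) ∧ ∀ x, φ x = 1 → x = 1 := by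
  obtain ⟨H, hH, hfin, φ, hφ, hrec⟩ := exists_recognizing_monoid
    -- The extra language containing just the empty word makes it the only word with value `1`, so
    -- emptiness can be read off the class.
    (fun o : Option ι => o.elim {1} L) (by
      rintro (_ | i)
      · exact finQuot_of_finite (Set.finite_singleton 1)
      · exact hL i)
  have : Nonempty (Fin (Nat.card H)) := ⟨Finite.equivFin H 1⟩
  have hpos : 0 < Nat.card H := Nat.card_pos
  -- The swap gives the unit the number `0`.
  let e : H ≃ Fin (Nat.card H) :=
    (Finite.equivFin H).trans (Equiv.swap (Finite.equivFin H 1) ⟨0, hpos⟩)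
  let dec : ℕ → H := fun n => if h : n < Nat.card H then e.symm ⟨n, h⟩ else 1
  have hdec : ∀ h, dec (e h) = h := fun h => by simp [dec]
  obtain ⟨cl, hcl⟩ := exists_lookup (fun b n => e (φ (FreeMonoid.of b) * dec n)) N (Nat.card H)
  obtain ⟨cr, hcr⟩ := exists_lookup (fun b n => e (dec n * φ (FreeMonoid.of b))) N (Nat.card H)
  refine ⟨H, hH, hfin, φ, fun h => e h, (Nat.card H, cl, cr), hφ,
    fun x y h => e.injective (Fin.ext h), by simp [e], fun h => (e h).2,
    fun n hn => ⟨e.symm ⟨n, hn⟩, by simp⟩, ?_, ?_, fun i => hrec (some i), ?_⟩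
  · intro b hb h
    exact (hcl b hb _ (e h).2).trans (by rw [hdec])
  · intro b hb h
    exact (hcr b hb _ (e h).2).trans (by rw [hdec])
  · intro x hx
    exact hrec none 1 x (by rw [hx, map_one]) rfl

theorem actTable_valid {H : Type} [Monoid H] {φ : FreeMonoid ℕ →* H} {enc : H → ℕ}
    {t : ActTable} {N : ℕ} (h1 : enc 1 = 0) (hlt : ∀ h, enc h < t.1)
    (hsurj : ∀ n < t.1, ∃ h, enc h = n)
    (hl : ∀ b < N, ∀ h, t.l b (enc h) = enc (φ (FreeMonoid.of b) * h))
    (hr : ∀ b < N, ∀ h, t.r (enc h) b = enc (h * φ (FreeMonoid.of b))) : t.Valid N := by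
  refine ⟨h1 ▸ hlt 1, fun b hb => ⟨?_, fun n hn => ?_⟩⟩
  · rw [← h1, hl b hb, hr b hb, mul_one, one_mul]
  · obtain ⟨h, rfl⟩ := hsurj n hn
    refine ⟨⟨hl b hb h ▸ hlt _, hr b hb h ▸ hlt _⟩, fun c hc => ?_⟩
    rw [hr c hc, hl b hb, hl b hb, hr c hc, mul_assoc]

/-- Only finitely many states occur, which makes the invariants finite lists. -/
theorem LoopReach.state_mem {T : List LoopTrans} {i p : ℕ × ℕ} {x w : List ℕ}
    (h : LoopReach (listTr T) i p x w) : p ∈ i :: T.map fun a => a.2.2 := by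
  cases h with
  | init => simp
  | silent _ ht => exact List.mem_cons_of_mem _ (List.mem_map_of_mem (f := fun a => a.2.2) ht)
  | push _ ht => exact List.mem_cons_of_mem _ (List.mem_map_of_mem (f := fun a => a.2.2) ht)
  | pop _ ht => exact List.mem_cons_of_mem _ (List.mem_map_of_mem (f := fun a => a.2.2) ht)
  | ext _ ht => exact List.mem_cons_of_mem _ (List.mem_map_of_mem (f := fun a => a.2.2) ht)

theorem exists_list_of_bounded {S : List (ℕ × ℕ)} {m n : ℕ} (p : (ℕ × ℕ) × ℕ × ℕ → Prop)
    (hp : ∀ a, p a → a.1 ∈ S ∧ a.2.1 < m ∧ a.2.2 < n) :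
    ∃ I : List ((ℕ × ℕ) × ℕ × ℕ), ∀ a, a ∈ I ↔ p a := by
  have hfin : {a | p a}.Finite := by
    refine ((List.finite_toSet S).prod ((Set.finite_lt_nat m).prod (Set.finite_lt_nat n))).subset ?_
    intro a ha
    exact hp a ha
  exact ⟨hfin.toFinset.toList, fun a => by simp⟩

/-- `Joint` does not record what the right machine has read before returning to its initial state
with empty queue; a further run from there is simply appended. -/
theorem LoopPair.Joint.concat {D : LoopPair} {p q : ℕ × ℕ} {x z y w : List ℕ}
    (h : D.Joint p D.2.2.1 x (w ++ z) []) (hr : LoopReach (listTr D.2.1) D.2.2.1 q y w) :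
    D.Joint p q x z y := by
  obtain ⟨w', hl, h⟩ := h
  exact ⟨w' ++ w, by simpa using hl, h.trans hr⟩

/-- The hypotheses `hQ`, `hI`, `hJ` are what the rational channel property provides. They serve,
respectively, the reading moves of the right machine, the pops of the left one and the pops of the
right one. -/
theorem exists_refutation {D : LoopPair}
    (hL : ∀ a ∈ D.1.1, ∃ k : LoopAct ℕ ℕ, a.2.1 = k.code)
    (hR : ∀ a ∈ D.2.1, ∃ k : LoopAct ℕ ℕ, a.2.1 = k.code)
    (hQ : FinQuot {z | D.Joint D.1.2.2 D.2.2.1 [] z.toList []})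
    (hI : ∀ (p : ℕ × ℕ) (H : Type) [Monoid H] [Finite H] (φ : FreeMonoid ℕ →* H) (g : H),
      FinQuot {x | ∃ z : FreeMonoid ℕ, φ z = g ∧ D.Joint p D.2.2.1 x.toList z.toList []})
    (hJ : ∀ (q : ℕ × ℕ) (H : Type) [Monoid H] [Finite H] (φ : FreeMonoid ℕ →* H) (g : H),
      FinQuot {y | ∃ z : FreeMonoid ℕ, φ z = g ∧ D.Joint D.1.2.2 q [] z.toList y.toList})
    (hD : ¬ D.Accepts) : ∃ c : Refutation, c.Valid D := by
  obtain ⟨N, hN⟩ : ∃ N, ∀ a ∈ D.1.1 ++ D.2.1, a.2.1.2 < N := by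
    refine ⟨((D.1.1 ++ D.2.1).map fun a => a.2.1.2).sum + 1, fun a ha => ?_⟩
    exact Nat.lt_succ_of_le (List.le_sum_of_mem (List.mem_map_of_mem (f := fun a => a.2.1.2) ha))
  have hNL : ∀ a ∈ D.1.1, a.2.1.2 < N := fun a ha => hN a (by simp [ha])
  have hNR : ∀ a ∈ D.2.1, a.2.1.2 < N := fun a ha => hN a (by simp [ha])
  -- The monoid `G` for channel `2` comes first, because the queue languages that `H` must recognize
  -- depend on the classes in `G`.
  obtain ⟨G, _, _, ψ, encG, s, ψsurj, encG_inj, encG_one, encG_lt, encG_surj, sl, sr, ψQ, ψ1⟩ :=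
    exists_actTable (fun _ : Unit => {z | D.Joint D.1.2.2 D.2.2.1 [] z.toList []})
      (fun _ => hQ) N
  obtain ⟨H, _, _, φ, encH, t, φsurj, encH_inj, encH_one, encH_lt, encH_surj, tl, tr, φL, φ1⟩ :=
    exists_actTable (ι := ({p // p ∈ D.1.2.1 :: D.1.1.map fun a => a.2.2} × G) ⊕
        ({q // q ∈ D.2.2.1 :: D.2.1.map fun a => a.2.2} × G))
      (Sum.elim
        (fun i => {x | ∃ z : FreeMonoid ℕ, ψ z = i.2 ∧ D.Joint i.1 D.2.2.1 x.toList z.toList []})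
        (fun i => {y | ∃ z : FreeMonoid ℕ, ψ z = i.2 ∧ D.Joint D.1.2.2 i.1 [] z.toList y.toList}))
      (by rintro (i | i); exacts [hI _ _ _ _, hJ _ _ _ _]) N
  obtain ⟨I, hIm⟩ := exists_list_of_bounded (S := D.1.2.1 :: D.1.1.map fun a => a.2.2)
    (m := t.1) (n := s.1)
    (fun a => ∃ x z : FreeMonoid ℕ, D.Joint a.1 D.2.2.1 x.toList z.toList [] ∧
      encH (φ x) = a.2.1 ∧ encG (ψ z) = a.2.2)
    (by
      rintro ⟨p, h, g⟩ ⟨x, z, ⟨w, hl, _⟩, rfl, rfl⟩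
      exact ⟨hl.state_mem, encH_lt _, encG_lt _⟩)
  obtain ⟨J, hJm⟩ := exists_list_of_bounded (S := D.2.2.1 :: D.2.1.map fun a => a.2.2)
    (m := t.1) (n := s.1)
    (fun a => ∃ z y : FreeMonoid ℕ, D.Joint D.1.2.2 a.1 [] z.toList y.toList ∧
      encH (φ y) = a.2.1 ∧ encG (ψ z) = a.2.2)
    (by
      rintro ⟨p, h, g⟩ ⟨z, y, ⟨w, _, hr⟩, rfl, rfl⟩
      exact ⟨hr.state_mem, encH_lt _, encG_lt _⟩)
  refine ⟨(N, t, s, I, J), hNL, hNR, actTable_valid encH_one encH_lt encH_surj tl tr,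
    actTable_valid encG_one encG_lt encG_surj sl sr, ?_, ?_, ?_, ?_, ?_⟩
  · exact (hIm _).2 ⟨1, 1, ⟨[], .init, .init⟩, by simpa using encH_one, by simpa using encG_one⟩
  · rintro ⟨p, k, q⟩ ha h hh g hg hm
    obtain ⟨k, rfl⟩ : ∃ k' : LoopAct ℕ ℕ, k = k'.code := hL _ ha
    have hb := hNL _ ha
    obtain ⟨h, rfl⟩ := encH_surj _ hh
    obtain ⟨g, rfl⟩ := encG_surj _ hg
    cases k with
    | silent =>
      obtain ⟨x, z, ⟨w, hl, hr⟩, hx, hz⟩ := (hIm _).1 hm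
      exact (hIm _).2 ⟨x, z, ⟨w, hl.silent ha, hr⟩, hx, hz⟩
    | push b =>
      obtain ⟨x, z, ⟨w, hl, hr⟩, hx, hz⟩ := (hIm _).1 hm
      refine (hIm _).2 ⟨x * FreeMonoid.of b, z, ⟨w, hl.push ha, hr⟩, ?_, hz⟩
      simp only [LoopAct.code] at hb hx ⊢
      rw [map_mul, encH_inj hx]
      exact (tr b hb h).symm
    | pop b =>
      obtain ⟨x, z, hj, hx, hz⟩ := (hIm _).1 hm
      obtain ⟨x', rfl⟩ := φsurj h
      have hp : p ∈ D.1.2.1 :: D.1.1.map fun a => a.2.2 := hj.choose_spec.1.state_mem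
      have hx' : φ x = φ (FreeMonoid.of b * x') := by
        rw [map_mul]
        exact encH_inj (hx.trans (tl b hb _))
      -- As `x` and `b x'` have the same class, `b x'` also coexists with a word of class `g`,
      -- possibly another word `z'`; now `b` can really be popped.
      obtain ⟨z', hz', w, hl, hr⟩ := φL (.inl (⟨p, hp⟩, g)) _ _ hx' ⟨z, encG_inj hz, hj⟩
      exact (hIm _).2 ⟨x', z', ⟨w, hl.pop ha, hr⟩, rfl, congrArg encG hz'⟩
    | ext c =>
      obtain ⟨x, z, ⟨w, hl, hr⟩, hx, hz⟩ := (hIm _).1 hm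
      refine (hIm _).2 ⟨x, z * FreeMonoid.of c, ⟨w, ?_, hr⟩, hx, ?_⟩
      · have := hl.ext ha
        rwa [List.append_assoc] at this
      · simp only [LoopAct.code] at hb hz ⊢
        rw [map_mul, encG_inj hz]
        exact (sr c hb g).symm
  · intro g hg h
    obtain ⟨x, z, hxz, hx, rfl⟩ := (hIm _).1 h
    obtain rfl := φ1 x (encH_inj (hx.trans encH_one.symm))
    exact (hJm _).2 ⟨z, 1, hxz, by simpa using encH_one, rfl⟩
  · rintro ⟨p, k, q⟩ ha h hh g hg hm
    obtain ⟨k, rfl⟩ : ∃ k' : LoopAct ℕ ℕ, k = k'.code := hR _ ha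
    have hb := hNR _ ha
    obtain ⟨h, rfl⟩ := encH_surj _ hh
    obtain ⟨g, rfl⟩ := encG_surj _ hg
    cases k with
    | silent =>
      obtain ⟨z, y, ⟨w, hl, hr⟩, hy, hz⟩ := (hJm _).1 hm
      exact (hJm _).2 ⟨z, y, ⟨w, hl, hr.silent ha⟩, hy, hz⟩
    | push b =>
      obtain ⟨z, y, ⟨w, hl, hr⟩, hy, hz⟩ := (hJm _).1 hm
      refine (hJm _).2 ⟨z, y * FreeMonoid.of b, ⟨w, hl, hr.push ha⟩, ?_, hz⟩
      simp only [LoopAct.code] at hb hy ⊢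
      rw [map_mul, encH_inj hy]
      exact (tr b hb h).symm
    | pop b =>
      obtain ⟨z, y, hj, hy, hz⟩ := (hJm _).1 hm
      obtain ⟨y', rfl⟩ := φsurj h
      have hp : p ∈ D.2.2.1 :: D.2.1.map fun a => a.2.2 := hj.choose_spec.2.state_mem
      have hy' : φ y = φ (FreeMonoid.of b * y') := by
        rw [map_mul]
        exact encH_inj (hy.trans (tl b hb _))
      obtain ⟨z', hz', w, hl, hr⟩ := φL (.inr (⟨p, hp⟩, g)) _ _ hy' ⟨z, encG_inj hz, hj⟩
      exact (hJm _).2 ⟨z', y', ⟨w, hl, hr.pop ha⟩, rfl, congrArg encG hz'⟩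
    | ext c =>
      obtain ⟨z, y, ⟨w, hl, hr⟩, hy, hz⟩ := (hJm _).1 hm
      obtain ⟨z', rfl⟩ := ψsurj g
      have hz' : ψ z = ψ (FreeMonoid.of c * z') := by
        rw [map_mul]
        exact encG_inj (hz.trans (sl c hb _))
      -- With `w` still unread, the channel can hold `w z`, hence also `w c z'`, which has the same
      -- class in `G`. The right machine then repeats its run on `w` and reads `c`.
      have hj : D.Joint D.1.2.2 D.2.2.1 [] (w ++ (c :: z'.toList)) [] :=
        ψQ () (FreeMonoid.ofList w * z) (FreeMonoid.ofList w * (FreeMonoid.of c * z'))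
          (by rw [map_mul, map_mul, hz']) ⟨[], hl, .init⟩
      refine (hJm _).2 ⟨z', y, ?_, hy, rfl⟩
      exact LoopPair.Joint.concat (w := w ++ [c]) (by simpa using hj) (hr.ext ha)
  · intro h
    obtain ⟨z, y, hzy, hy, hz⟩ := (hJm _).1 h
    obtain rfl := φ1 y (encH_inj (hy.trans encH_one.symm))
    obtain rfl := ψ1 z (encG_inj (hz.trans encG_one.symm))
    exact hD hzy

/-! ### Validity of a refutation is primitive recursive -/

section Primrec

variable {α β γ : Type*} [Primcodable α] [Primcodable β] [Primcodable γ]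

theorem Primrec.left {f : α → β × γ} (hf : Primrec f) : Primrec fun x => (f x).1 :=
  Primrec.fst.comp hf

theorem Primrec.right {f : α → β × γ} (hf : Primrec f) : Primrec fun x => (f x).2 :=
  Primrec.snd.comp hf

theorem Primrec.lift {f : α → β} (hf : Primrec f) : Primrec fun x : α × γ => f x.1 :=
  hf.comp Primrec.fst

theorem PrimrecPred.ball_list {f : α → List β} {p : α → β → Prop} (hf : Primrec f)
    (hp : PrimrecPred fun x : α × β => p x.1 x.2) : PrimrecPred fun a => ∀ b ∈ f a, p a b :=
  PrimrecRel.comp (PrimrecRel.forall_mem_list (R := fun b a => p a b)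
    (PrimrecRel.swap (r := p) hp)) hf Primrec.id

theorem PrimrecPred.bex_list {f : α → List β} {p : α → β → Prop} (hf : Primrec f)
    (hp : PrimrecPred fun x : α × β => p x.1 x.2) : PrimrecPred fun a => ∃ b ∈ f a, p a b :=
  PrimrecRel.comp (PrimrecRel.exists_mem_list (R := fun b a => p a b)
    (PrimrecRel.swap (r := p) hp)) hf Primrec.id

theorem PrimrecPred.ball_lt {f : α → ℕ} {p : α → ℕ → Prop} (hf : Primrec f)
    (hp : PrimrecPred fun x : α × ℕ => p x.1 x.2) : PrimrecPred fun a => ∀ b < f a, p a b :=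
  (PrimrecPred.ball_list (Primrec.list_range.comp hf) hp).of_eq fun _ => by
    simp only [List.mem_range]

theorem PrimrecPred.imp {p q : α → Prop} (hp : PrimrecPred p) (hq : PrimrecPred q) :
    PrimrecPred fun a => p a → q a :=
  (hp.not.or hq).of_eq fun _ => imp_iff_not_or.symm

theorem PrimrecPred.mem_list {f : α → β} {l : α → List β} (hf : Primrec f) (hl : Primrec l) :
    PrimrecPred fun a => f a ∈ l a :=
  (PrimrecPred.bex_list (p := fun a b => b = f a) hl
    (PrimrecRel.comp Primrec.eq Primrec.snd (hf.comp Primrec.fst))).of_eq fun a => by simp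

theorem PrimrecPred.eq {f g : α → β} (hf : Primrec f) (hg : Primrec g) :
    PrimrecPred fun a => f a = g a :=
  PrimrecRel.comp Primrec.eq hf hg

theorem PrimrecPred.lt {f g : α → ℕ} (hf : Primrec f) (hg : Primrec g) :
    PrimrecPred fun a => f a < g a :=
  PrimrecRel.comp Primrec.nat_lt hf hg

theorem Primrec.lookup {c : α → List ℕ} {f g : α → ℕ} (hc : Primrec c) (hf : Primrec f)
    (hg : Primrec g) : Primrec fun a => lookup (c a) (f a) (g a) :=
  (Primrec.list_getD 0).comp hc (Primrec₂.natPair.comp hf hg)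

theorem Primrec.actTable_l {t : α → ActTable} {f g : α → ℕ} (ht : Primrec t) (hf : Primrec f)
    (hg : Primrec g) : Primrec fun a => (t a).l (f a) (g a) :=
  Primrec.lookup ht.right.left hf hg

theorem Primrec.actTable_r {t : α → ActTable} {f g : α → ℕ} (ht : Primrec t) (hf : Primrec f)
    (hg : Primrec g) : Primrec fun a => (t a).r (f a) (g a) :=
  Primrec.lookup ht.right.right hg hf

theorem PrimrecPred.actTable_valid {t : α → ActTable} {n : α → ℕ} (ht : Primrec t)
    (hn : Primrec n) : PrimrecPred fun a => (t a).Valid (n a) := by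
  refine (PrimrecPred.lt (.const 0) ht.left).and (PrimrecPred.ball_lt hn ?_)
  replace ht := ht.comp (Primrec.fst (α := α) (β := ℕ))
  replace hn := hn.comp (Primrec.fst (α := α) (β := ℕ))
  have hb : Primrec fun x : α × ℕ => x.2 := Primrec.snd
  refine (PrimrecPred.eq (ht.actTable_l hb (.const 0)) (ht.actTable_r (.const 0) hb)).and
    (PrimrecPred.ball_lt ht.left ?_)
  replace ht := ht.comp (Primrec.fst (α := α × ℕ) (β := ℕ))
  replace hn := hn.comp (Primrec.fst (α := α × ℕ) (β := ℕ))
  replace hb := hb.comp (Primrec.fst (α := α × ℕ) (β := ℕ))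
  have hh : Primrec fun x : (α × ℕ) × ℕ => x.2 := Primrec.snd
  refine ((PrimrecPred.lt (ht.actTable_l hb hh) ht.left).and
    (PrimrecPred.lt (ht.actTable_r hh hb) ht.left)).and (PrimrecPred.ball_lt hn ?_)
  replace ht := ht.comp (Primrec.fst (α := (α × ℕ) × ℕ) (β := ℕ))
  replace hb := hb.comp (Primrec.fst (α := (α × ℕ) × ℕ) (β := ℕ))
  replace hh := hh.comp (Primrec.fst (α := (α × ℕ) × ℕ) (β := ℕ))
  have hc : Primrec fun x : ((α × ℕ) × ℕ) × ℕ => x.2 := Primrec.snd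
  exact PrimrecPred.eq (ht.actTable_l hb (ht.actTable_r hh hc))
    (ht.actTable_r (ht.actTable_l hb hh) hc)

theorem PrimrecPred.writerClosed {t s : α → ActTable} {I : α → List ((ℕ × ℕ) × ℕ × ℕ)}
    {T : α → List LoopTrans} (ht : Primrec t) (hs : Primrec s) (hI : Primrec I)
    (hT : Primrec T) : PrimrecPred fun x => WriterClosed (t x) (s x) (I x) (T x) := by
  refine PrimrecPred.ball_list hT (PrimrecPred.ball_lt ht.left.lift
    (PrimrecPred.ball_lt hs.left.lift.lift ?_))
  have ha : Primrec fun x : ((α × LoopTrans) × ℕ) × ℕ => x.1.1.2 := Primrec.snd.lift.lift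
  have hh : Primrec fun x : ((α × LoopTrans) × ℕ) × ℕ => x.1.2 := Primrec.snd.lift
  have hg : Primrec fun x : ((α × LoopTrans) × ℕ) × ℕ => x.2 := Primrec.snd
  have kind : ∀ n, PrimrecPred fun x : ((α × LoopTrans) × ℕ) × ℕ => x.1.1.2.2.1.1 = n :=
    fun n => PrimrecPred.eq ha.right.left.left (.const n)
  have hb := ha.right.left.right
  refine (PrimrecPred.mem_list ?_ hI.lift.lift.lift).imp
    (PrimrecPred.mem_list ?_ hI.lift.lift.lift)
  · exact ha.left.pair ((Primrec.ite (kind 2) (ht.lift.lift.lift.actTable_l hb hh) hh).pair hg)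
  · exact ha.right.right.pair ((Primrec.ite (kind 1) (ht.lift.lift.lift.actTable_r hh hb) hh).pair
      (Primrec.ite (kind 3) (hs.lift.lift.lift.actTable_r hg hb) hg))

theorem PrimrecPred.readerClosed {t s : α → ActTable} {J : α → List ((ℕ × ℕ) × ℕ × ℕ)}
    {T : α → List LoopTrans} (ht : Primrec t) (hs : Primrec s) (hJ : Primrec J)
    (hT : Primrec T) : PrimrecPred fun x => ReaderClosed (t x) (s x) (J x) (T x) := by
  refine PrimrecPred.ball_list hT (PrimrecPred.ball_lt ht.left.lift
    (PrimrecPred.ball_lt hs.left.lift.lift ?_))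
  have ha : Primrec fun x : ((α × LoopTrans) × ℕ) × ℕ => x.1.1.2 := Primrec.snd.lift.lift
  have hh : Primrec fun x : ((α × LoopTrans) × ℕ) × ℕ => x.1.2 := Primrec.snd.lift
  have hg : Primrec fun x : ((α × LoopTrans) × ℕ) × ℕ => x.2 := Primrec.snd
  have kind : ∀ n, PrimrecPred fun x : ((α × LoopTrans) × ℕ) × ℕ => x.1.1.2.2.1.1 = n :=
    fun n => PrimrecPred.eq ha.right.left.left (.const n)
  have hb := ha.right.left.right
  refine (PrimrecPred.mem_list ?_ hJ.lift.lift.lift).imp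
    (PrimrecPred.mem_list ?_ hJ.lift.lift.lift)
  · exact ha.left.pair ((Primrec.ite (kind 2) (ht.lift.lift.lift.actTable_l hb hh) hh).pair
      (Primrec.ite (kind 3) (hs.lift.lift.lift.actTable_l hb hg) hg))
  · exact ha.right.right.pair
      ((Primrec.ite (kind 1) (ht.lift.lift.lift.actTable_r hh hb) hh).pair hg)

theorem PrimrecPred.refutation_valid {c : α → Refutation} {D : α → LoopPair} (hc : Primrec c)
    (hD : Primrec D) : PrimrecPred fun x => (c x).Valid (D x) := by
  have hN := hc.left
  have ht := hc.right.left
  have hs := hc.right.right.left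
  have hI := hc.right.right.right.left
  have hJ := hc.right.right.right.right
  have hL := hD.left
  have hR := hD.right
  refine (PrimrecPred.ball_list hL.left (.lt Primrec.snd.right.left.right hN.lift)).and <|
    (PrimrecPred.ball_list hR.left (.lt Primrec.snd.right.left.right hN.lift)).and <|
    (PrimrecPred.actTable_valid ht hN).and <| (PrimrecPred.actTable_valid hs hN).and <|
    (PrimrecPred.mem_list (hL.right.left.pair (.const (0, 0))) hI).and <|
    (PrimrecPred.writerClosed ht hs hI hL.left).and <|
    (PrimrecPred.ball_lt hs.left (.imp (.mem_list ?_ hI.lift) (.mem_list ?_ hJ.lift))).and <|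
    (PrimrecPred.readerClosed ht hs hJ hR.left).and
    (PrimrecPred.mem_list (hR.right.right.pair (.const (0, 0))) hJ).not
  · exact hL.right.right.lift.pair ((Primrec.const 0).pair Primrec.snd)
  · exact hR.right.left.lift.pair ((Primrec.const 0).pair Primrec.snd)

end Primrec

/-! ### Enumeration of runs and the combined search -/

/-- The states and words that a machine with a queue reaches by one transition. -/
def loopStep (T : List LoopTrans) (c : (ℕ × ℕ) × List ℕ × List ℕ) :
    List ((ℕ × ℕ) × List ℕ × List ℕ) :=
  T.flatMap fun a =>
    if a.1 = c.1 ∧ a.2.1 = (0, 0) then [(a.2.2, c.2.1, c.2.2)]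
    else if a.1 = c.1 ∧ a.2.1.1 = 1 then [(a.2.2, c.2.1 ++ [a.2.1.2], c.2.2)]
    else if a.1 = c.1 ∧ a.2.1.1 = 2 ∧ c.2.1.head? = some a.2.1.2 then
      [(a.2.2, c.2.1.tail, c.2.2)]
    else if a.1 = c.1 ∧ a.2.1.1 = 3 then [(a.2.2, c.2.1, c.2.2 ++ [a.2.1.2])]
    else []

/-- The states and words that a machine with a queue reaches by `n` transitions. -/
def loopSteps (T : List LoopTrans) (i : ℕ × ℕ) (n : ℕ) : List ((ℕ × ℕ) × List ℕ × List ℕ) :=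
  n.rec [(i, [], [])] fun _ l => l.flatMap (loopStep T)

theorem loopReach_iff_exists_mem_loopSteps {T : List LoopTrans} {i p : ℕ × ℕ} {x w : List ℕ} :
    LoopReach (listTr T) i p x w ↔ ∃ n, (p, x, w) ∈ loopSteps T i n := by
  constructor
  · have succ : ∀ {c c' n}, c ∈ loopSteps T i n → c' ∈ loopStep T c →
        ∃ n, c' ∈ loopSteps T i n :=
      fun {c c' n} h h' => ⟨n + 1, List.mem_flatMap.2 ⟨c, h, h'⟩⟩
    intro h
    induction h with
    | init => exact ⟨0, List.mem_singleton_self _⟩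
    | silent _ ht ih =>
      obtain ⟨n, hn⟩ := ih
      exact succ hn (List.mem_flatMap.2 ⟨_, ht, by simp [LoopAct.code]⟩)
    | push _ ht ih =>
      obtain ⟨n, hn⟩ := ih
      exact succ hn (List.mem_flatMap.2 ⟨_, ht, by simp [LoopAct.code]⟩)
    | pop _ ht ih =>
      obtain ⟨n, hn⟩ := ih
      exact succ hn (List.mem_flatMap.2 ⟨_, ht, by simp [LoopAct.code]⟩)
    | ext _ ht ih =>
      obtain ⟨n, hn⟩ := ih
      exact succ hn (List.mem_flatMap.2 ⟨_, ht, by simp [LoopAct.code]⟩)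
  · rintro ⟨n, h⟩
    induction n generalizing p x w with
    | zero =>
      obtain ⟨rfl, rfl, rfl⟩ : p = i ∧ x = [] ∧ w = [] := by simpa [loopSteps] using h
      exact .init
    | succ n ih =>
      obtain ⟨⟨p', x', w'⟩, hc, hp⟩ := List.mem_flatMap.1 h
      obtain ⟨⟨r, ⟨k, b⟩, q⟩, ha, hq⟩ := List.mem_flatMap.1 hp
      have hr := ih hc
      dsimp only at hq
      split_ifs at hq with h1 h2 h3 h4
      · obtain ⟨rfl, hk⟩ := h1
        rw [hk] at ha
        obtain ⟨rfl, rfl, rfl⟩ : p = q ∧ x = x' ∧ w = w' := by simpa using hq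
        exact hr.silent ha
      · obtain ⟨rfl, rfl⟩ := h2
        obtain ⟨rfl, rfl, rfl⟩ : p = q ∧ x = x' ++ [b] ∧ w = w' := by simpa using hq
        exact hr.push ha
      · obtain ⟨rfl, rfl, hx⟩ := h3
        obtain ⟨rfl, rfl, rfl⟩ : p = q ∧ x = x'.tail ∧ w = w' := by simpa using hq
        obtain ⟨l, rfl⟩ := List.head?_eq_some_iff.1 hx
        exact hr.pop ha
      · obtain ⟨rfl, rfl⟩ := h4
        obtain ⟨rfl, rfl, rfl⟩ : p = q ∧ x = x' ∧ w = w' ++ [b] := by simpa using hq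
        exact hr.ext ha
      · simp at hq

theorem Primrec.loopStep {α : Type*} [Primcodable α] {T : α → List LoopTrans}
    {c : α → (ℕ × ℕ) × List ℕ × List ℕ} (hT : Primrec T) (hc : Primrec c) :
    Primrec fun x => loopStep (T x) (c x) := by
  refine Primrec.list_flatMap hT ?_
  have ha : Primrec fun x : α × LoopTrans => x.2 := Primrec.snd
  replace hc : Primrec fun x : α × LoopTrans => c x.1 := hc.lift
  have hs := PrimrecPred.eq ha.left hc.left
  have hb := ha.right.left.right
  have kind : ∀ n, PrimrecPred fun x : α × LoopTrans => x.2.2.1.1 = n :=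
    fun n => PrimrecPred.eq ha.right.left.left (.const n)
  have single : ∀ {f : α × LoopTrans → (ℕ × ℕ) × List ℕ × List ℕ}, Primrec f →
      Primrec fun x => [f x] := fun hf => Primrec.list_cons.comp hf (.const [])
  refine Primrec.ite (hs.and (.eq ha.right.left (.const (0, 0))))
    (single (ha.right.right.pair (hc.right.left.pair hc.right.right))) <|
    Primrec.ite (hs.and (kind 1)) (single (ha.right.right.pair
      ((Primrec.list_concat.comp hc.right.left hb).pair hc.right.right))) <|
    Primrec.ite (hs.and ((kind 2).and (.eq (Primrec.list_head?.comp hc.right.left)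
      (Primrec.option_some.comp hb)))) (single (ha.right.right.pair
      ((Primrec.list_tail.comp hc.right.left).pair hc.right.right))) <|
    Primrec.ite (hs.and (kind 3)) (single (ha.right.right.pair
      (hc.right.left.pair (Primrec.list_concat.comp hc.right.right hb)))) (.const [])

theorem Primrec.loopSteps {α : Type*} [Primcodable α] {T : α → List LoopTrans} {i : α → ℕ × ℕ}
    {n : α → ℕ} (hT : Primrec T) (hi : Primrec i) (hn : Primrec n) :
    Primrec fun x => loopSteps (T x) (i x) (n x) := by
  refine (Primrec.nat_rec' (g := fun x => [(i x, ([] : List ℕ), ([] : List ℕ))])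
    (h := fun x p => p.2.flatMap (_root_.loopStep (T x))) hn
    (Primrec.list_cons.comp (hi.pair (.const ([], []))) (.const [])) ?_).of_eq fun _ => rfl
  exact Primrec.list_flatMap Primrec.snd.right (Primrec.loopStep hT.lift.lift Primrec.snd)

/-- `LoopPair.Accepts`, with bounds for the lengths of the two runs. -/
def LoopPair.AcceptsIn (D : LoopPair) (n : ℕ × ℕ) : Prop :=
  ∃ c ∈ loopSteps D.1.1 D.1.2.1 n.1, ∃ c' ∈ loopSteps D.2.1 D.2.2.1 n.2,
    (c.1 = D.1.2.2 ∧ c.2.1 = []) ∧ (c'.1 = D.2.2.2 ∧ c'.2.1 = []) ∧ c.2.2 = c'.2.2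

theorem LoopPair.accepts_iff_exists_acceptsIn {D : LoopPair} :
    D.Accepts ↔ ∃ n, D.AcceptsIn n := by
  constructor
  · rintro ⟨w, hl, hr⟩
    rw [List.append_nil] at hl
    obtain ⟨m, hm⟩ := loopReach_iff_exists_mem_loopSteps.1 hl
    obtain ⟨n, hn⟩ := loopReach_iff_exists_mem_loopSteps.1 hr
    exact ⟨(m, n), _, hm, _, hn, ⟨rfl, rfl⟩, ⟨rfl, rfl⟩, rfl⟩
  · rintro ⟨⟨m, n⟩, ⟨p, x, w⟩, hm, ⟨q, y, w'⟩, hn, ⟨rfl, rfl⟩, ⟨rfl, rfl⟩, rfl⟩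
    exact ⟨w, by simpa using loopReach_iff_exists_mem_loopSteps.2 ⟨m, hm⟩,
      loopReach_iff_exists_mem_loopSteps.2 ⟨n, hn⟩⟩

theorem PrimrecPred.acceptsIn {α : Type*} [Primcodable α] {D : α → LoopPair} {n : α → ℕ × ℕ}
    (hD : Primrec D) (hn : Primrec n) : PrimrecPred fun x => (D x).AcceptsIn (n x) := by
  refine PrimrecPred.bex_list (hD.left.left.loopSteps hD.left.right.left hn.left)
    (PrimrecPred.bex_list (hD.right.left.loopSteps hD.right.right.left hn.right).lift ?_)
  have hc : Primrec fun x : (α × ((ℕ × ℕ) × List ℕ × List ℕ)) × ((ℕ × ℕ) × List ℕ × List ℕ) =>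
    x.1.2 := Primrec.snd.lift
  have hc' : Primrec fun x : (α × ((ℕ × ℕ) × List ℕ × List ℕ)) × ((ℕ × ℕ) × List ℕ × List ℕ) =>
    x.2 := Primrec.snd
  exact ((PrimrecPred.eq hc.left hD.left.right.right.lift.lift).and
      (.eq hc.right.left (.const []))).and
    (((PrimrecPred.eq hc'.left hD.right.right.right.lift.lift).and
      (.eq hc'.right.left (.const []))).and (.eq hc.right.right hc'.right.right))

open Classical in
/-- The search for an accepting run or a refutation. -/
noncomputable def LoopPair.test (D : LoopPair) (n : ℕ) : Option Bool :=
  (Encodable.decode (α := (ℕ × ℕ) × Refutation) n).bind fun c =>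
    if D.AcceptsIn c.1 then some true else if c.2.Valid D then some false else none

-- The classical case distinctions in `test` are harmless, since both conditions are primitive
-- recursive predicates.
open Classical in
theorem LoopPair.test_primrec : Primrec₂ LoopPair.test := by
  refine Primrec.option_bind (Primrec.decode.comp Primrec.snd) ?_
  have hD : Primrec fun x : (LoopPair × ℕ) × ((ℕ × ℕ) × Refutation) => x.1.1 :=
    Primrec.fst.lift
  have hc : Primrec fun x : (LoopPair × ℕ) × ((ℕ × ℕ) × Refutation) => x.2 := Primrec.snd
  exact Primrec.ite (PrimrecPred.acceptsIn hD hc.left) (.const _)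
    (Primrec.ite (PrimrecPred.refutation_valid hc.right hD) (.const _) (.const _))

/-- The search finds the correct answer if there is a refutation of every pair that does not
accept. -/
theorem LoopPair.exists_mem_rfindOpt_test {D : LoopPair}
    (h : ¬ D.Accepts → ∃ c : Refutation, c.Valid D) :
    ∃ a, a ∈ Nat.rfindOpt D.test ∧ (a = true ↔ D.Accepts) := by
  -- Every answer found is correct in any case; `h` only guarantees that the search halts.
  have sound : ∀ n a, a ∈ D.test n → (a = true ↔ D.Accepts) := by
    intro n a ha
    obtain ⟨c, -, hc⟩ := Option.bind_eq_some_iff.1 ha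
    split_ifs at hc with h1 h2
    · cases hc
      exact iff_of_true rfl (accepts_iff_exists_acceptsIn.2 ⟨_, h1⟩)
    · cases hc
      exact iff_of_false Bool.false_ne_true h2.not_accepts
  have total : ∃ n a, a ∈ D.test n := by
    by_cases hD : D.Accepts
    · obtain ⟨m, hm⟩ := accepts_iff_exists_acceptsIn.1 hD
      -- A code carries both kinds of witness; the half that is not needed is arbitrary.
      refine ⟨Encodable.encode ((m, default) : (ℕ × ℕ) × Refutation), true, ?_⟩
      simp only [test, Encodable.encodek, Option.bind_some, if_pos hm, Option.mem_def]
    · obtain ⟨c, hc⟩ := h hD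
      refine ⟨Encodable.encode (((0, 0), c) : (ℕ × ℕ) × Refutation), false, ?_⟩
      have : ¬ D.AcceptsIn (0, 0) := fun h => hD (accepts_iff_exists_acceptsIn.2 ⟨_, h⟩)
      simp only [test, Encodable.encodek, Option.bind_some, if_neg this, if_pos hc, Option.mem_def]
  have hdom := Nat.rfindOpt_dom.2 total
  obtain ⟨n, hn⟩ := Nat.rfindOpt_spec (Part.get_mem hdom)
  exact ⟨_, Part.get_mem hdom, sound n _ hn⟩

/-! ### Transport of runs along numberings -/

/-- Renaming of the letters of an action. -/
def LoopAct.map {M C M' C' : Type*} (f : M → M') (g : C → C') : LoopAct M C → LoopAct M' C'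
  | silent => silent
  | push b => push (f b)
  | pop b => pop (f b)
  | ext c => ext (g c)

section Transport

variable {K M C K' M' C' : Type*} {tr : K → LoopAct M C → K → Prop}
  {tr' : K' → LoopAct M' C' → K' → Prop} {eK : K → K'} {eM : M → M'} {eC : C → C'} {i : K}

theorem LoopReach.map (h : ∀ p a q, tr p a q → tr' (eK p) (a.map eM eC) (eK q)) {p : K}
    {x : List M} {w : List C} (hp : LoopReach tr i p x w) :
    LoopReach tr' (eK i) (eK p) (x.map eM) (w.map eC) := by
  induction hp with
  | init => exact .init
  | silent _ ht ih => exact ih.silent (h _ _ _ ht)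
  | push _ ht ih => rw [List.map_append]; exact ih.push (h _ _ _ ht)
  | pop _ ht ih => exact LoopReach.pop ih (h _ _ _ ht)
  | ext _ ht ih => rw [List.map_append]; exact ih.ext (h _ _ _ ht)

/-- A run from an encoded state never leaves the encoded states. At a pop, injectivity identifies
the letter of the transition with the first letter of the lifted queue. -/
theorem LoopReach.exists_of_map (hM : Function.Injective eM)
    (h : ∀ p a' q', tr' (eK p) a' q' → ∃ a q, a' = LoopAct.map eM eC a ∧ q' = eK q ∧ tr p a q)
    {p' : K'} {x' : List M'} {w' : List C'} (hp : LoopReach tr' (eK i) p' x' w') :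
    ∃ p x w, p' = eK p ∧ x' = x.map eM ∧ w' = w.map eC ∧ LoopReach tr i p x w := by
  induction hp with
  | init => exact ⟨i, [], [], rfl, rfl, rfl, .init⟩
  | silent _ ht ih =>
    obtain ⟨p, x, w, rfl, rfl, rfl, hp⟩ := ih
    obtain ⟨a, q, ha, rfl, hq⟩ := h _ _ _ ht
    cases a <;> simp only [LoopAct.map, reduceCtorEq] at ha
    exact ⟨q, x, w, rfl, rfl, rfl, hp.silent hq⟩
  | push _ ht ih =>
    obtain ⟨p, x, w, rfl, rfl, rfl, hp⟩ := ih
    obtain ⟨a, q, ha, rfl, hq⟩ := h _ _ _ ht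
    cases a <;> simp only [LoopAct.map, reduceCtorEq, LoopAct.push.injEq] at ha
    subst ha
    exact ⟨q, _, w, rfl, by simp, rfl, hp.push hq⟩
  | pop _ ht ih =>
    obtain ⟨p, x, w, rfl, hx, rfl, hp⟩ := ih
    obtain ⟨a, q, ha, rfl, hq⟩ := h _ _ _ ht
    cases a <;> simp only [LoopAct.map, reduceCtorEq, LoopAct.pop.injEq] at ha
    subst ha
    obtain ⟨c, x, rfl, hc, rfl⟩ := List.map_eq_cons_iff.1 hx.symm
    rw [hM hc] at hp
    exact ⟨q, x, w, rfl, rfl, rfl, hp.pop hq⟩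
  | ext _ ht ih =>
    obtain ⟨p, x, w, rfl, rfl, rfl, hp⟩ := ih
    obtain ⟨a, q, ha, rfl, hq⟩ := h _ _ _ ht
    cases a <;> simp only [LoopAct.map, reduceCtorEq, LoopAct.ext.injEq] at ha
    subst ha
    exact ⟨q, x, _, rfl, rfl, by simp, hp.ext hq⟩

/-- The relation `R'` restricted to the image of `eX` is the image of the relation `R`. -/
def Encodes {X A X' A' : Type*} (eX : X → X') (eA : A → A') (R : X → A → X → Prop)
    (R' : X' → A' → X' → Prop) : Prop :=
  ∀ s b' s', R' (eX s) b' s' ↔ ∃ b t, b' = eA b ∧ s' = eX t ∧ R s b t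

theorem pairTr_encodes {X Y A X' Y' A' : Type*} {eX : X → X'} {eY : Y → Y'} {eA : A → A'}
    (hA : Function.Injective eA)
    {oSend : X → A → X → Prop} {oRecv : X → M → X → Prop} {iRecv : Y → A → Y → Prop}
    {iSend : Y → M → Y → Prop} {iExt : Y → C → Y → Prop}
    {oSend' : X' → A' → X' → Prop} {oRecv' : X' → M' → X' → Prop} {iRecv' : Y' → A' → Y' → Prop}
    {iSend' : Y' → M' → Y' → Prop} {iExt' : Y' → C' → Y' → Prop}
    (h1 : Encodes eX eA oSend oSend') (h2 : Encodes eX eM oRecv oRecv')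
    (h3 : Encodes eY eA iRecv iRecv') (h4 : Encodes eY eM iSend iSend')
    (h5 : Encodes eY eC iExt iExt') :
    Encodes (Prod.map eX eY) (LoopAct.map eM eC) (PairTr oSend oRecv iRecv iSend iExt)
      (PairTr oSend' oRecv' iRecv' iSend' iExt') := by
  rintro ⟨s, t⟩ a' q'
  constructor
  · intro h
    cases h with
    | hand ha hb =>
      obtain ⟨b, s1, rfl, rfl, hs⟩ := (h1 _ _ _).1 ha
      obtain ⟨b', t1, hb', rfl, ht⟩ := (h3 _ _ _).1 hb
      -- Both partners handle the same number, hence the same message.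
      obtain rfl := hA hb'
      exact ⟨.silent, (s1, t1), rfl, rfl, .hand hs ht⟩
    | pop ha =>
      obtain ⟨b, s1, rfl, rfl, hs⟩ := (h2 _ _ _).1 ha
      exact ⟨.pop b, (s1, t), rfl, rfl, .pop hs⟩
    | push ha =>
      obtain ⟨b, s1, rfl, rfl, hs⟩ := (h4 _ _ _).1 ha
      exact ⟨.push b, (s, s1), rfl, rfl, .push hs⟩
    | ext ha =>
      obtain ⟨b, s1, rfl, rfl, hs⟩ := (h5 _ _ _).1 ha
      exact ⟨.ext b, (s, s1), rfl, rfl, .ext hs⟩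
  · rintro ⟨a, q, rfl, rfl, h⟩
    cases h with
    | hand ha hb =>
      exact .hand ((h1 _ _ _).2 ⟨_, _, rfl, rfl, ha⟩) ((h3 _ _ _).2 ⟨_, _, rfl, rfl, hb⟩)
    | pop ha => exact .pop ((h2 _ _ _).2 ⟨_, _, rfl, rfl, ha⟩)
    | push ha => exact .push ((h4 _ _ _).2 ⟨_, _, rfl, rfl, ha⟩)
    | ext ha => exact .ext ((h5 _ _ _).2 ⟨_, _, rfl, rfl, ha⟩)

theorem Encodes.loopReach_iff (h : Encodes eK (LoopAct.map eM eC) tr tr')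
    (hM : Function.Injective eM) {p' : K'} {x' : List M'} {w' : List C'} :
    LoopReach tr' (eK i) p' x' w' ↔
      ∃ p x w, p' = eK p ∧ x' = x.map eM ∧ w' = w.map eC ∧ LoopReach tr i p x w := by
  constructor
  · exact LoopReach.exists_of_map hM fun p a' q' => (h p a' q').1
  · rintro ⟨p, x, w, rfl, rfl, rfl, hp⟩
    exact hp.map fun p a q ht => (h _ _ _).2 ⟨a, q, rfl, rfl, ht⟩

end Transport

/-! ### Computing the two machines from an instance -/

/-- The transitions of a ring of two machines as one machine with a queue; `dir` says whether the
external words are received. -/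
def loopTable (outer inner : List (TransitionCode 5)) (m n : ℕ) (rdv loop ext : Fin 5)
    (dir : Bool) : List LoopTrans :=
  (List.range m).flatMap fun s => (List.range n).flatMap fun t =>
    (outer.flatMap fun o => if o.1 = s ∧ o.2.1 = true ∧ o.2.2.1 = loop then
      [((s, t), (2, o.2.2.2.1), (o.2.2.2.2, t))] else []) ++
    (inner.flatMap fun j => if j.1 = t ∧ j.2.1 = false ∧ j.2.2.1 = loop then
      [((s, t), (1, j.2.2.2.1), (s, j.2.2.2.2))] else []) ++
    (inner.flatMap fun j => if j.1 = t ∧ j.2.1 = dir ∧ j.2.2.1 = ext then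
      [((s, t), (3, j.2.2.2.1), (s, j.2.2.2.2))] else []) ++
    (outer.flatMap fun o => inner.flatMap fun j =>
      if (o.1 = s ∧ o.2.1 = false ∧ o.2.2.1 = rdv) ∧
        (j.1 = t ∧ j.2.1 = true ∧ j.2.2.1 = rdv) ∧ o.2.2.2.1 = j.2.2.2.1 then
      [((s, t), (0, 0), (o.2.2.2.2, j.2.2.2.2))] else [])

section LoopTable

variable {outer inner : List (TransitionCode 5)} {m n : ℕ} {rdv loop ext : Fin 5} {dir : Bool}

/-- A move of one machine leaves the state of its partner arbitrary, so the table runs over all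
pairs of states; the bounds on the source state keep it finite. -/
theorem mem_loopTable_iff {a : LoopTrans} : a ∈ loopTable outer inner m n rdv loop ext dir ↔
    a.1.1 < m ∧ a.1.2 < n ∧ ∃ k : LoopAct ℕ ℕ, a.2.1 = k.code ∧
      PairTr (fun s b s' => (s, false, rdv, b, s') ∈ outer)
        (fun s b s' => (s, true, loop, b, s') ∈ outer)
        (fun s b s' => (s, true, rdv, b, s') ∈ inner)
        (fun s b s' => (s, false, loop, b, s') ∈ inner)
        (fun s b s' => (s, dir, ext, b, s') ∈ inner) a.1 k a.2.2 := by
  constructor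
  · intro h
    simp only [loopTable, List.mem_flatMap, List.mem_range, List.mem_append] at h
    obtain ⟨s, hs, t, ht, ((⟨⟨o1, o2, o3, o4, o5⟩, ho, h⟩ | ⟨⟨o1, o2, o3, o4, o5⟩, ho, h⟩) |
      ⟨⟨o1, o2, o3, o4, o5⟩, ho, h⟩) |
      ⟨⟨o1, o2, o3, o4, o5⟩, ho, ⟨j1, j2, j3, j4, j5⟩, hj, h⟩⟩ := h
    · split_ifs at h with hc
      · obtain ⟨rfl, rfl, rfl⟩ := hc
        obtain rfl := List.mem_singleton.1 h
        exact ⟨hs, ht, .pop o4, rfl, .pop ho⟩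
      · simp at h
    · split_ifs at h with hc
      · obtain ⟨rfl, rfl, rfl⟩ := hc
        obtain rfl := List.mem_singleton.1 h
        exact ⟨hs, ht, .push o4, rfl, .push ho⟩
      · simp at h
    · split_ifs at h with hc
      · obtain ⟨rfl, rfl, rfl⟩ := hc
        obtain rfl := List.mem_singleton.1 h
        exact ⟨hs, ht, .ext o4, rfl, .ext ho⟩
      · simp at h
    · dsimp only at h
      split_ifs at h with hc
      · obtain ⟨⟨rfl, rfl, rfl⟩, ⟨rfl, rfl, rfl⟩, rfl⟩ := hc
        obtain rfl := List.mem_singleton.1 h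
        exact ⟨hs, ht, .silent, rfl, .hand ho hj⟩
      · simp at h
  · obtain ⟨⟨s, t⟩, c, q⟩ := a
    rintro ⟨hs, ht, k, rfl, h⟩
    simp only [loopTable, List.mem_flatMap, List.mem_range, List.mem_append]
    refine ⟨s, hs, t, ht, ?_⟩
    cases h with
    | hand ha hb => exact .inr ⟨_, ha, _, hb, by simp [LoopAct.code]⟩
    | pop ha => exact .inl (.inl (.inl ⟨_, ha, by simp [LoopAct.code]⟩))
    | push ha => exact .inl (.inl (.inr ⟨_, ha, by simp [LoopAct.code]⟩))
    | ext ha => exact .inl (.inr ⟨_, ha, by simp [LoopAct.code]⟩)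

theorem LoopAct.code_injective : Function.Injective LoopAct.code := by
  intro a b h
  cases a <;> cases b <;> simp_all [LoopAct.code]

theorem listTr_loopTable_iff {p q : ℕ × ℕ} {k : LoopAct ℕ ℕ} (h1 : p.1 < m) (h2 : p.2 < n) :
    listTr (loopTable outer inner m n rdv loop ext dir) p k q ↔
      PairTr (fun s b s' => (s, false, rdv, b, s') ∈ outer)
        (fun s b s' => (s, true, loop, b, s') ∈ outer)
        (fun s b s' => (s, true, rdv, b, s') ∈ inner)
        (fun s b s' => (s, false, loop, b, s') ∈ inner)
        (fun s b s' => (s, dir, ext, b, s') ∈ inner) p k q := by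
  refine mem_loopTable_iff.trans ⟨?_, fun h => ⟨h1, h2, k, rfl, h⟩⟩
  rintro ⟨-, -, k', hk, h⟩
  rwa [LoopAct.code_injective hk]

theorem Primrec.loopTable {α : Type*} [Primcodable α] {outer inner : α → List (TransitionCode 5)}
    {m n : α → ℕ} (ho : Primrec outer) (hi : Primrec inner) (hm : Primrec m) (hn : Primrec n) :
    Primrec fun x => loopTable (outer x) (inner x) (m x) (n x) rdv loop ext dir := by
  refine Primrec.list_flatMap (Primrec.list_range.comp hm)
    (Primrec.list_flatMap (Primrec.list_range.comp hn.lift) ?_)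
  have hs : Primrec fun x : (α × ℕ) × ℕ => x.1.2 := Primrec.snd.lift
  have ht : Primrec fun x : (α × ℕ) × ℕ => x.2 := Primrec.snd
  replace ho := (ho.lift (γ := ℕ)).lift (γ := ℕ)
  replace hi := (hi.lift (γ := ℕ)).lift (γ := ℕ)
  have single : ∀ {β : Type _} [Primcodable β] {f : β → LoopTrans}, Primrec f →
      Primrec fun x => [f x] := fun hf => Primrec.list_cons.comp hf (.const [])
  refine Primrec.list_append.comp (Primrec.list_append.comp (Primrec.list_append.comp
    (Primrec.list_flatMap ho ?_) (Primrec.list_flatMap hi ?_)) (Primrec.list_flatMap hi ?_))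
    (Primrec.list_flatMap ho (Primrec.list_flatMap hi.lift ?_))
  · have h : Primrec fun x : ((α × ℕ) × ℕ) × TransitionCode 5 => x.2 := Primrec.snd
    exact Primrec.ite ((PrimrecPred.eq h.left hs.lift).and ((PrimrecPred.eq h.right.left
      (.const true)).and (.eq h.right.right.left (.const loop))))
      (single ((hs.lift.pair ht.lift).pair (((Primrec.const 2).pair h.right.right.right.left).pair
        (h.right.right.right.right.pair ht.lift)))) (.const [])
  · have h : Primrec fun x : ((α × ℕ) × ℕ) × TransitionCode 5 => x.2 := Primrec.snd
    exact Primrec.ite ((PrimrecPred.eq h.left ht.lift).and ((PrimrecPred.eq h.right.left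
      (.const false)).and (.eq h.right.right.left (.const loop))))
      (single ((hs.lift.pair ht.lift).pair (((Primrec.const 1).pair h.right.right.right.left).pair
        (hs.lift.pair h.right.right.right.right)))) (.const [])
  · have h : Primrec fun x : ((α × ℕ) × ℕ) × TransitionCode 5 => x.2 := Primrec.snd
    exact Primrec.ite ((PrimrecPred.eq h.left ht.lift).and ((PrimrecPred.eq h.right.left
      (.const dir)).and (.eq h.right.right.left (.const ext))))
      (single ((hs.lift.pair ht.lift).pair (((Primrec.const 3).pair h.right.right.right.left).pair
        (hs.lift.pair h.right.right.right.right)))) (.const [])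
  · have h : Primrec fun x : (((α × ℕ) × ℕ) × TransitionCode 5) × TransitionCode 5 => x.1.2 :=
      Primrec.snd.lift
    have h' : Primrec fun x : (((α × ℕ) × ℕ) × TransitionCode 5) × TransitionCode 5 => x.2 :=
      Primrec.snd
    exact Primrec.ite (((PrimrecPred.eq h.left hs.lift.lift).and ((PrimrecPred.eq h.right.left
        (.const false)).and (.eq h.right.right.left (.const rdv)))).and
      (((PrimrecPred.eq h'.left ht.lift.lift).and ((PrimrecPred.eq h'.right.left
        (.const true)).and (.eq h'.right.right.left (.const rdv)))).and
        (.eq h.right.right.right.left h'.right.right.right.left)))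
      (single ((hs.lift.lift.pair ht.lift.lift).pair ((Primrec.const (0, 0)).pair
        (h.right.right.right.right.pair h'.right.right.right.right)))) (.const [])

end LoopTable

/-- The two machines with queues that are given by an instance for `twoPairsGraph`. -/
def InstanceCode.loopPair (c : InstanceCode 4 5) : LoopPair :=
  ((loopTable (c.2.2.2.1 0) (c.2.2.2.1 1) (c.2.1 0) (c.2.1 1) 0 1 2 false,
    (c.2.2.1 0, c.2.2.1 1), (c.2.2.2.2 0, c.2.2.2.2 1)),
  (loopTable (c.2.2.2.1 3) (c.2.2.2.1 2) (c.2.1 3) (c.2.1 2) 3 4 2 true,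
    (c.2.2.1 3, c.2.2.1 2), (c.2.2.2.2 3, c.2.2.2.2 2)))

theorem InstanceCode.loopPair_primrec : Primrec InstanceCode.loopPair := by
  have hc : Primrec fun c : InstanceCode 4 5 => c := Primrec.id
  have app : ∀ {α : Type} [Primcodable α] {f : InstanceCode 4 5 → Fin 4 → α}, Primrec f →
      ∀ i, Primrec fun c => f c i := fun hf i => Primrec.fin_app.comp hf (.const i)
  have hl := hc.right.right.right.left
  exact ((Primrec.loopTable (app hl 0) (app hl 1) (app hc.right.left 0)
      (app hc.right.left 1)).pair (((app hc.right.right.left 0).pair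
      (app hc.right.right.left 1)).pair ((app hc.right.right.right.right 0).pair
      (app hc.right.right.right.right 1)))).pair
    ((Primrec.loopTable (app hl 3) (app hl 2) (app hc.right.left 3)
      (app hc.right.left 2)).pair (((app hc.right.right.left 3).pair
      (app hc.right.right.left 2)).pair ((app hc.right.right.right.right 3).pair
      (app hc.right.right.right.right 2))))

/-! ### From the rational channel property to refutations -/

namespace CFSMProtocol

namespace Presentation

variable {n e : ℕ} {G : DiGraph (Fin n) (Fin e)} {P : CFSMProtocol.{u, v} G} (D : P.Presentation)

/-- The number of a message. -/
def msg (ξ : Fin e) (b : P.M ξ) : ℕ := D.enumM ξ b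

/-- The number of a local state. -/
def state (j : Fin n) (s : P.K j) : ℕ := D.enumK j s

theorem msg_injective (ξ : Fin e) : Function.Injective (D.msg ξ) :=
  fun _ _ h => (D.enumM ξ).injective (Fin.ext h)

theorem state_injective (j : Fin n) : Function.Injective (D.state j) :=
  fun _ _ h => (D.enumK j).injective (Fin.ext h)

theorem encodes_recv {j : Fin n} {ξ : Fin e} (hξ : G.head ξ = j) :
    Encodes (D.state j) (D.msg ξ) (fun s b s' => (s, CommAction.recv ξ hξ b, s') ∈ P.trans j)
      (fun s b s' => (s, true, ξ, b, s') ∈ (D.list j).map (D.transitionCode j)) := by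
  intro s b' s'
  refine List.mem_map.trans ?_
  constructor
  · rintro ⟨⟨p, a, q⟩, hm, h⟩
    cases a with
    | recv η hη b =>
      simp only [transitionCode, Prod.mk.injEq, true_and] at h
      obtain ⟨hp, rfl, rfl, rfl⟩ := h
      obtain rfl := D.state_injective j hp
      exact ⟨b, q, rfl, rfl, (D.mem_list _ _).1 hm⟩
    | send η hη b => simp [transitionCode] at h
  · rintro ⟨b, q, rfl, rfl, h⟩
    exact ⟨_, (D.mem_list _ _).2 h, rfl⟩

theorem encodes_send {j : Fin n} {ξ : Fin e} (hξ : G.tail ξ = j) :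
    Encodes (D.state j) (D.msg ξ) (fun s b s' => (s, CommAction.send ξ hξ b, s') ∈ P.trans j)
      (fun s b s' => (s, false, ξ, b, s') ∈ (D.list j).map (D.transitionCode j)) := by
  intro s b' s'
  refine List.mem_map.trans ?_
  constructor
  · rintro ⟨⟨p, a, q⟩, hm, h⟩
    cases a with
    | recv η hη b => simp [transitionCode] at h
    | send η hη b =>
      simp only [transitionCode, Prod.mk.injEq, true_and] at h
      obtain ⟨hp, rfl, rfl, rfl⟩ := h
      obtain rfl := D.state_injective j hp
      exact ⟨b, q, rfl, rfl, (D.mem_list _ _).1 hm⟩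
  · rintro ⟨b, q, rfl, rfl, h⟩
    exact ⟨_, (D.mem_list _ _).2 h, rfl⟩

/-- The content of a channel, with the messages replaced by their numbers. -/
def word (ξ : Fin e) : P.ChannelContent →* FreeMonoid ℕ :=
  (FreeMonoid.map (D.msg ξ)).comp (Pi.evalMonoidHom _ ξ)

theorem word_toList (ξ : Fin e) (C : P.ChannelContent) :
    (D.word ξ C).toList = (C ξ).toList.map (D.msg ξ) := rfl

theorem word_eq_one_iff {ξ : Fin e} {C : P.ChannelContent} : D.word ξ C = 1 ↔ C ξ = 1 :=
  List.map_eq_nil_iff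

theorem word_injective {C C' : P.ChannelContent} (h : ∀ ξ, D.word ξ C = D.word ξ C') : C = C' :=
  funext fun ξ => List.map_injective_iff.2 (D.msg_injective ξ) (h ξ)

/-- The contents that can coexist with a composite state, restricted to those with given empty
channels and a given value of one channel in a finite monoid, and projected to one channel. -/
theorem finQuot_contents {S : P.CompositeState} (hS : IsRationalSubset (P.contents S))
    (ξ η : Fin e) (Z : Finset (Fin e)) {H : Type} [Monoid H] [Finite H] (φ : FreeMonoid ℕ →* H)
    (g : H) : FinQuot {x | ∃ C ∈ P.contents S, D.word ξ C = x ∧ (∀ ζ ∈ Z, D.word ζ C = 1) ∧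
      φ (D.word η C) = g} := by
  -- Under multiplication, every letter has value `0` and only the empty word has value `1`.
  -- Emptiness of a channel thus becomes a condition on a value in a finite monoid.
  let nil : FreeMonoid ℕ →* ZMod 2 := FreeMonoid.lift fun _ => 0
  have hnil : ∀ w, nil w = 1 ↔ w = 1 := by
    intro w
    refine ⟨fun h => ?_, fun h => by rw [h, map_one]⟩
    cases w using FreeMonoid.casesOn with
    | one => rfl
    | of_mul b w =>
      rw [map_mul, FreeMonoid.lift_eval_of, zero_mul] at h
      exact absurd h (by decide)
  let ψ : P.ChannelContent →* (Z → ZMod 2) × H :=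
    (MonoidHom.pi fun ζ : Z => nil.comp (D.word ζ)).prod (φ.comp (D.word η))
  convert hS.finQuot (D.word ξ) ψ (1, g) using 6 with x C
  simp [ψ, funext_iff, hnil]

end Presentation

variable {P : CFSMProtocol.{u, v} twoPairsGraph} (D : P.Presentation)

namespace Presentation

theorem left_encodes : Encodes (Prod.map (D.state 0) (D.state 1))
    (LoopAct.map (D.msg 1) (D.msg 2)) P.leftTr
    (listTr (loopTable ((D.list 0).map (D.transitionCode 0)) ((D.list 1).map (D.transitionCode 1))
      (D.numK 0) (D.numK 1) 0 1 2 false)) := by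
  intro p a q
  rw [listTr_loopTable_iff (D.enumK 0 p.1).2 (D.enumK 1 p.2).2]
  exact pairTr_encodes (D.msg_injective 0) (D.encodes_send (j := 0) (ξ := 0) rfl)
    (D.encodes_recv (j := 0) (ξ := 1) rfl) (D.encodes_recv (j := 1) (ξ := 0) rfl)
    (D.encodes_send (j := 1) (ξ := 1) rfl) (D.encodes_send (j := 1) (ξ := 2) rfl) p a q

theorem right_encodes : Encodes (Prod.map (D.state 3) (D.state 2))
    (LoopAct.map (D.msg 4) (D.msg 2)) P.rightTr
    (listTr (loopTable ((D.list 3).map (D.transitionCode 3)) ((D.list 2).map (D.transitionCode 2))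
      (D.numK 3) (D.numK 2) 3 4 2 true)) := by
  intro p a q
  rw [listTr_loopTable_iff (D.enumK 3 p.1).2 (D.enumK 2 p.2).2]
  exact pairTr_encodes (D.msg_injective 3) (D.encodes_send (j := 3) (ξ := 3) rfl)
    (D.encodes_recv (j := 3) (ξ := 4) rfl) (D.encodes_recv (j := 2) (ξ := 3) rfl)
    (D.encodes_send (j := 2) (ξ := 4) rfl) (D.encodes_recv (j := 2) (ξ := 2) rfl) p a q

/-- The reachability in the numeric machines is the reachability of the global states with
the channels `0` and `3` empty. -/
theorem joint_iff (S₀ : P.CompositeState) {p q : ℕ × ℕ} {x z y : List ℕ} :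
    (InstanceCode.loopPair (D.code S₀)).Joint p q x z y ↔ ∃ S C, P.Reachable (S, C) ∧
      C 0 = 1 ∧ C 3 = 1 ∧ p = (D.state 0 (S 0), D.state 1 (S 1)) ∧
      q = (D.state 3 (S 3), D.state 2 (S 2)) ∧ (D.word 1 C).toList = x ∧
      (D.word 2 C).toList = z ∧ (D.word 4 C).toList = y := by
  have hl := fun p x w => D.left_encodes.loopReach_iff (i := (P.init 0, P.init 1))
    (D.msg_injective 1) (p' := p) (x' := x) (w' := w)
  have hr := fun p x w => D.right_encodes.loopReach_iff (i := (P.init 3, P.init 2))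
    (D.msg_injective 4) (p' := p) (x' := x) (w' := w)
  constructor
  · rintro ⟨w, h1, h2⟩
    obtain ⟨p, x, v, rfl, rfl, hv, hp⟩ := (hl _ _ _).1 h1
    obtain ⟨q, y, w, rfl, rfl, rfl, hq⟩ := (hr _ _ _).1 h2
    obtain ⟨w', z, rfl, hw, rfl⟩ := List.append_eq_map_iff.1 hv
    obtain rfl := List.map_injective_iff.2 (D.msg_injective 2) hw
    obtain ⟨S, C, h, h0, h1, h3, h2, c0, c1, c2, c3, c4⟩ := realized_right hq _ hp
    refine ⟨S, C, h, c0, c3, ?_, ?_, ?_, ?_, ?_⟩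
    · rw [h0, h1]; rfl
    · rw [h3, h2]; rfl
    · rw [word_toList, c1]
    · rw [word_toList, c2]
    · rw [word_toList, c4]
  · rintro ⟨S, C, h, h0, h3, rfl, rfl, rfl, rfl, rfl⟩
    obtain ⟨w, h1, h2⟩ := (reachable_iff_loopReach h0 h3).1 h
    exact ⟨w.map (D.msg 2), (hl _ _ _).2 ⟨_, _, _, rfl, rfl, by simp [word_toList], h1⟩,
      (hr _ _ _).2 ⟨_, _, _, rfl, rfl, rfl, h2⟩⟩

/-- The four local states determine `S`, so `Joint` is a section of the relation L(S), the form to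
which rationality applies. The target `S₀` in the code has no influence on `Joint`. -/
theorem joint_state_iff (S₀ S : P.CompositeState) {x z y : List ℕ} :
    (InstanceCode.loopPair (D.code S₀)).Joint (D.state 0 (S 0), D.state 1 (S 1))
      (D.state 3 (S 3), D.state 2 (S 2)) x z y ↔ ∃ C ∈ P.contents S, D.word 0 C = 1 ∧
      D.word 3 C = 1 ∧ (D.word 1 C).toList = x ∧ (D.word 2 C).toList = z ∧
      (D.word 4 C).toList = y := by
  rw [joint_iff]
  simp only [word_eq_one_iff]
  constructor
  · rintro ⟨S', C, h, h0, h3, hp, hq, hC⟩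
    rw [Prod.mk.injEq] at hp hq
    obtain rfl : S = S' := by
      funext j; fin_cases j
      exacts [D.state_injective _ hp.1, D.state_injective _ hp.2, D.state_injective _ hq.2,
        D.state_injective _ hq.1]
    exact ⟨C, h, h0, h3, hC⟩
  · rintro ⟨C, h, h0, h3, hC⟩
    exact ⟨S, C, h, h0, h3, rfl, rfl, hC⟩

theorem accepts_iff_stable (S : P.CompositeState) :
    (InstanceCode.loopPair (D.code S)).Accepts ↔ P.Stable S := by
  refine (D.joint_state_iff S S).trans ⟨?_, fun h => ?_⟩
  · rintro ⟨C, h, h0, h3, h1, h2, h4⟩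
    obtain rfl : C = 1 := by
      refine D.word_injective fun ξ => ?_
      rw [map_one]
      fin_cases ξ
      exacts [h0, h1, h2, h3, h4]
    exact h
  · exact ⟨1, h, map_one _, map_one _, by simp, by simp, by simp⟩

theorem exists_refutation (hP : P.RationalChannelProperty) (S : P.CompositeState)
    (hS : ¬ (InstanceCode.loopPair (D.code S)).Accepts) :
    ∃ c : Refutation, c.Valid (InstanceCode.loopPair (D.code S)) := by
  have empty : FinQuot (∅ : Set (FreeMonoid ℕ)) := finQuot_of_finite Set.finite_empty
  have coded : ∀ {outer inner m n rdv loop ext dir},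
      ∀ a ∈ loopTable outer inner m n rdv loop ext dir, ∃ k : LoopAct ℕ ℕ, a.2.1 = k.code :=
    fun a ha => (mem_loopTable_iff.1 ha).2.2.imp fun _ h => h.1
  refine _root_.exists_refutation coded coded ?_ ?_ ?_ hS
  -- The left pair is in its target states and the right pair in its initial ones; the trivial
  -- monoid imposes no further condition on channel `2`.
  · convert D.finQuot_contents (hP (Function.update (Function.update S 2 (P.init 2)) 3 (P.init 3)))
      2 2 {0, 1, 3, 4} (1 : FreeMonoid ℕ →* Unit) 1 using 3 with z
    refine (D.joint_state_iff S
      (Function.update (Function.update S 2 (P.init 2)) 3 (P.init 3))).trans ?_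
    simp only [Finset.mem_insert, Finset.mem_singleton, forall_eq_or_imp, forall_eq]
    constructor
    · rintro ⟨C, hC, h0, h3, h1, h2, h4⟩
      exact ⟨C, hC, h2, ⟨h0, h1, h3, h4⟩, trivial⟩
    · rintro ⟨C, hC, h2, ⟨h0, h1, h3, h4⟩, -⟩
      exact ⟨C, hC, h0, h3, congrArg FreeMonoid.toList h1, congrArg FreeMonoid.toList h2,
        congrArg FreeMonoid.toList h4⟩
  · intro p H _ _ φ g
    by_cases hp : ∃ S' : P.CompositeState, p = (D.state 0 (S' 0), D.state 1 (S' 1))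
    · obtain ⟨S', rfl⟩ := hp
      convert D.finQuot_contents
        (hP (Function.update (Function.update S' 2 (P.init 2)) 3 (P.init 3)))
        1 2 {0, 3, 4} φ g using 3 with x
      refine (exists_congr fun z => and_congr_right' (D.joint_state_iff S
        (Function.update (Function.update S' 2 (P.init 2)) 3 (P.init 3)))).trans ?_
      simp only [Finset.mem_insert, Finset.mem_singleton, forall_eq_or_imp, forall_eq]
      constructor
      · rintro ⟨z, hz, C, hC, h0, h3, h1, h2, h4⟩
        exact ⟨C, hC, h1, ⟨h0, h3, h4⟩, (congrArg φ h2).trans hz⟩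
      · rintro ⟨C, hC, h1, ⟨h0, h3, h4⟩, hz⟩
        exact ⟨_, hz, C, hC, h0, h3, congrArg FreeMonoid.toList h1, rfl,
          congrArg FreeMonoid.toList h4⟩
    -- A pair of numbers that codes no local states is never reached.
    · convert empty
      refine Set.eq_empty_of_forall_notMem ?_
      rintro x ⟨z, -, h⟩
      obtain ⟨S', _, _, _, _, h, _⟩ := (D.joint_iff S).1 h
      exact hp ⟨S', h⟩
  · intro q H _ _ φ g
    by_cases hq : ∃ S' : P.CompositeState, q = (D.state 3 (S' 3), D.state 2 (S' 2))
    · obtain ⟨S', rfl⟩ := hq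
      -- Here the left pair is in its target states while the right pair is in those coded by `q`.
      convert D.finQuot_contents
        (hP (Function.update (Function.update S' 0 (S 0)) 1 (S 1)))
        4 2 {0, 1, 3} φ g using 3 with y
      refine (exists_congr fun z => and_congr_right' (D.joint_state_iff S
        (Function.update (Function.update S' 0 (S 0)) 1 (S 1)))).trans ?_
      simp only [Finset.mem_insert, Finset.mem_singleton, forall_eq_or_imp, forall_eq]
      constructor
      · rintro ⟨z, hz, C, hC, h0, h3, h1, h2, h4⟩
        exact ⟨C, hC, h4, ⟨h0, h1, h3⟩, (congrArg φ h2).trans hz⟩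
      · rintro ⟨C, hC, h4, ⟨h0, h1, h3⟩, hz⟩
        exact ⟨_, hz, C, hC, h0, h3, congrArg FreeMonoid.toList h1, rfl,
          congrArg FreeMonoid.toList h4⟩
    · convert empty
      refine Set.eq_empty_of_forall_notMem ?_
      rintro x ⟨z, -, h⟩
      obtain ⟨S', _, _, _, _, _, h, _⟩ := (D.joint_iff S).1 h
      exact hq ⟨S', h⟩

end Presentation

end CFSMProtocol

theorem theorem10p4 :
    StableCompositeStateDecidable.{u, v} twoPairsGraph
      (fun P => P.RationalChannelProperty) := by
  refine ⟨fun c => Nat.rfindOpt (InstanceCode.loopPair c).test,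
    Partrec.rfindOpt (LoopPair.test_primrec.to_comp.comp
      (InstanceCode.loopPair_primrec.to_comp.comp Computable.fst) Computable.snd), ?_⟩
  intro P hP D S
  obtain ⟨a, ha, h⟩ := LoopPair.exists_mem_rfindOpt_test (D.exists_refutation hP S)
  exact ⟨a, ha, h.trans (D.accepts_iff_stable S)⟩
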